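/- Let $\alpha$ be an indeterminate, $F=\mathbb{Q}(\alpha)$, and $\Lambda_F=F[p_1,p_2,\dots]$ the ring of symmetric functions over $F$, with $p_k=\sum_i x_i^k$ the power sums and $m_\lambda$ the monomial symmetric functions. For a partition $\lambda=(\lambda_1\ge\lambda_2\ge\cdots)$ let $l(\lambda)$ be its number of non-zero parts, $m_a(\lambda)$ the multiplicity of $a$ as a part, $z_\lambda=\prod_{a\ge1}a^{m_a(\lambda)}m_a(\lambda)!$ and $p_\lambda=p_{\lambda_1}p_{\lambda_2}\cdots$. Let $\langle p_\lambda,p_\mu\rangle=\delta_{\lambda\mu}\,\alpha^{l(\lambda)}z_\lambda$ be the Jack scalar product on $\Lambda_F$. Denote by $\le$ the dominance order on the partitions of a given integer $n\ge0$. Let $P_\lambda$ ($\lambda\vdash n$) be the Jack symmetric functions, defined by $P_\lambda=\sum_{\mu\le\lambda}c_{\lambda\mu}m_\mu$ with $c_{\lambda\mu}\in F$, $c_{\lambda\lambda}=1$, and $\langle P_\lambda,P_\mu\rangle=0$ for $\lambda\ne\mu$. Let $Q_\lambda=\langle P_\lambda,P_\lambda\rangle^{-1}P_\lambda$ be the dual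 Jack functions. Let $Q_k=\sum_{\lambda\vdash k}\alpha^{-l(\lambda)}z_\lambda^{-1}p_\lambda$ for an integer $k\ge0$, and $q_\lambda=Q_{\lambda_1}Q_{\lambda_2}\cdots Q_{\lambda_{l(\lambda)}}$. Put $$e'_\lambda(\alpha)=\tfrac12\,\alpha\sum_i\lambda_i^2-\sum_i i\,\lambda_i .$$ For a partition $\lambda$, indices $i<j$ and an integer $k$ with $\lambda_j\ge k>0$, let $r_j^i(k).\lambda$ be the partition obtained by rearranging $(\lambda_1,\dots,\lambda_i+k,\dots,\lambda_j-k,\dots)$ in decreasing order; $r^i_j(k)$ is then called a moving up operator for $\lambda$. Let $M_*(\mu)$ be the set of all partitions $\nu$ such that $\mu$ is obtained from $\nu$ by one moving up operator. For $\mu=r_j^i(k).\nu$ put $$r_{\nu\mu}=(1+\delta_{\nu_i\nu_j})^{-1}\,m_{\nu_i}(\nu)\,\bigl(m_{\nu_j}(\nu)-\delta_{\nu_i\nu_j}\bigr)\,(\nu_i-\nu_j+2k),$$ which depends only on $\nu$ and $\mu$. **Theorem.** Let $\lambda\vdash n$. There are $C_{\lambda\mu}(\alpha)\in F$, for $\mu\vdash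 n$ with $\mu\ge\lambda$, such that $$Q_\lambda=\sum_{\mu\ge\lambda}C_{\lambda\mu}(\alpha)\,q_\mu .$$ For any such coefficients and every $\mu>\lambda$ one has $e'_\lambda(\alpha)-e'_\mu(\alpha)\ne0$ and $$C_{\lambda\mu}(\alpha)=\frac{\displaystyle\sum_{\lambda\le\nu\in M_*(\mu)}C_{\lambda\nu}(\alpha)\,r_{\nu\mu}}{e'_\lambda(\alpha)-e'_\mu(\alpha)} .$$ -/

import Mathlib

namespace Jack

/-- The coefficient field `F = ℚ(α)` of rational functions in one indeterminate. -/
abbrev F : Type := RatFunc ℚ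

/-- The indeterminate `α`. -/
noncomputable abbrev α : F := RatFunc.X

/-- The ring `Λ_F = F[p₁, p₂, …]` of symmetric functions over `F`, in its presentation as the
polynomial ring in the power sums; the variable with index `k : ℕ+` is `p_k`. -/
abbrev Sym : Type := MvPolynomial ℕ+ F

/-! ### Partitions -/

section Partitions

variable {n : ℕ}

/-- The rows of a partition in decreasing order, indexed from `0` and continued by zeros:
`row la i` is the part usually written `λ_{i+1}`. -/
def row (la : n.Partition) (i : ℕ) : ℕ :=
  (la.parts.sort (· ≥ ·)).getD i 0

/-- The length `l(λ)`. -/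
def len (la : n.Partition) : ℕ := la.parts.card

/-- The multiplicity `m_a(λ)` of `a` as a part of `λ`. -/
def mult (la : n.Partition) (a : ℕ) : ℕ := la.parts.count a

/-- `z_λ = ∏_i i^{m_i} m_i!`. -/
def zee (la : n.Partition) : ℕ :=
  ∏ i ∈ la.parts.toFinset, i ^ mult la i * (mult la i).factorial

/-- The dominance order on partitions of `n`: `Dom la mu` means `λ ≤ μ`. -/
def Dom (la mu : n.Partition) : Prop :=
  ∀ i : ℕ, ∑ j ∈ Finset.range i, row la j ≤ ∑ j ∈ Finset.range i, row mu j

noncomputable instance (la : n.Partition) : DecidablePred (Dom la) :=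
  Classical.decPred _

/-- The partitions `μ` of `n` with `λ ≤ μ`. -/
noncomputable def above (la : n.Partition) : Finset n.Partition :=
  Finset.univ.filter fun mu => Dom la mu

/-- The partitions `μ` of `n` with `μ ≤ λ`. -/
noncomputable def below (la : n.Partition) : Finset n.Partition :=
  Finset.univ.filter fun mu => la ∈ above mu

end Partitions

/-! ### Symmetric functions in the variables `x₀, x₁, …` -/

/-- The power sum `∑_i x_i ^ k` (`k ≥ 1`), as a formal power series in infinitely many
variables. -/
noncomputable def powerSum (k : ℕ+) : MvPowerSeries ℕ F := by
  classical
  exact fun d => if ∃ i : ℕ, d = Finsupp.single i (k : ℕ) then 1 else 0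

/-- The monomial symmetric function `m_λ`, the sum of all distinct monomials whose multiset of
nonzero exponents is the multiset of parts of `λ`. -/
noncomputable def monomialSymm {n : ℕ} (la : n.Partition) : MvPowerSeries ℕ F := by
  classical
  exact fun d => if d.support.val.map (fun i => d i) = la.parts then 1 else 0

/-- The realization of an element of `F[p₁, p₂, …]` as a symmetric function in the variables
`x₀, x₁, …`, replacing `p_k` by `∑_i x_i ^ k`. -/
noncomputable def realize : Sym →ₐ[F] MvPowerSeries ℕ F :=
  MvPolynomial.aeval powerSum

/-- `p_λ = p_{λ₁} p_{λ₂} ⋯`. -/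
noncomputable def pPart {n : ℕ} (la : n.Partition) : Sym :=
  (la.parts.map fun k => (MvPolynomial.X k.toPNat' : Sym)).prod

/-- The Jack scalar product, the bilinear form for which the monomials in the `p_k` are orthogonal
and `∏_k p_k ^ {m_k}` has square norm `∏_k α^{m_k} k^{m_k} m_k!`, that is,
`⟨p_λ, p_μ⟩ = δ_{λμ} α^{l(λ)} z_λ`. -/
noncomputable def scalarProduct (f g : Sym) : F :=
  ∑ d ∈ f.support, f.coeff d * g.coeff d *
    d.prod fun k m => α ^ m * ((k : ℕ) : F) ^ m * (m.factorial : F)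

/-- `P` is the family of Jack symmetric functions `P_λ(α)`, `λ ⊢ n`:
`P_λ = ∑_{μ ≤ λ} c_{λμ} m_μ` with `c_{λλ} = 1`, and `⟨P_λ, P_μ⟩ = 0` for `λ ≠ μ`. -/
def IsJackFamily (n : ℕ) (P : n.Partition → Sym) : Prop :=
  (∀ la : n.Partition, ∃ c : n.Partition → F, c la = 1 ∧
    realize (P la) = ∑ mu ∈ below la, c mu • monomialSymm mu) ∧
  (∀ la mu : n.Partition, la ≠ mu → scalarProduct (P la) (P mu) = 0)

/-- The dual Jack function `Q_λ = ⟨P_λ, P_λ⟩⁻¹ P_λ`. -/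
noncomputable def dualJack {n : ℕ} (P : n.Partition → Sym) (la : n.Partition) : Sym :=
  (scalarProduct (P la) (P la))⁻¹ • P la

/-- The one-row function `Q_n(α) = ∑_{λ ⊢ n} α^{-l(λ)} z_λ⁻¹ p_λ`. -/
noncomputable def qOne (n : ℕ) : Sym :=
  ∑ la : n.Partition, ((α ^ len la)⁻¹ * ((zee la : ℕ) : F)⁻¹) • pPart la

/-- The generalized homogeneous symmetric function `q_λ = Q_{λ₁} Q_{λ₂} ⋯`. -/
noncomputable def q {n : ℕ} (la : n.Partition) : Sym :=
  (la.parts.map qOne).prod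

/-! ### The ingredients of the recursion -/

section Recursion

variable {n : ℕ}

/-- `e'_λ(α) = (1/2) α ∑_i λ_i² - ∑_i i λ_i`, with rows numbered from `1` in the formula. -/
noncomputable def e' (la : n.Partition) : F :=
  (1 / 2) * α * ∑ i ∈ Finset.range (len la), (row la i : F) ^ 2
    - ∑ i ∈ Finset.range (len la), ((i + 1 : ℕ) : F) * (row la i : F)

/-- The rows of `λ` after `k` squares have been moved from row `j` to row `i`. -/
def movedRow (la : n.Partition) (i j k t : ℕ) : ℕ :=
  if t = i then row la i + k else if t = j then row la j - k else row la t

/-- `r_j^i(k)` is a moving up operator for `λ` (`i < j`, `λ_j ≥ k > 0`) and `μ = r_j^i(k).λ`, the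
rearrangement in decreasing order of `λ` with `k` squares moved from row `j` to row `i`. -/
def IsMoveUp (la mu : n.Partition) (i j k : ℕ) : Prop :=
  i < j ∧ 0 < k ∧ k ≤ row la j ∧
    mu.parts = ((Multiset.range (len la)).map (movedRow la i j k)).filter (· ≠ 0)

/-- `M^*(λ)`, the set of partitions obtained from `λ` by one moving up operator. -/
def movingUp (la : n.Partition) : Set n.Partition :=
  {mu | ∃ i j k, IsMoveUp la mu i j k}

/-- `M_*(μ)`, the set of partitions from which `μ` is obtained by one moving up operator. -/
noncomputable def movingDown (mu : n.Partition) : Finset n.Partition := by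
  classical
  exact Finset.univ.filter fun la => mu ∈ movingUp la

/-- `(1+δ_{λ_iλ_j})⁻¹ m_{λ_i}(λ) (m_{λ_j}(λ) - δ_{λ_iλ_j}) (λ_i - λ_j + 2k)`. -/
noncomputable def moveCoeff (la : n.Partition) (i j k : ℕ) : F :=
  (1 + if row la i = row la j then 1 else 0)⁻¹ * (mult la (row la i) : F) *
    ((mult la (row la j) : F) - if row la i = row la j then 1 else 0) *
    ((row la i : F) - (row la j : F) + 2 * (k : F))

/-- The coefficients `r_{λμ}`: `moveCoeff la i j k` if `μ = r_j^i(k).λ`, `e'_λ` if `λ = μ`, and `0`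
otherwise. The value does not depend on the chosen operator: see `r_eq_of_isMoveUp`. -/
noncomputable def r (la mu : n.Partition) : F := by
  classical
  exact if h : ∃ t : ℕ × ℕ × ℕ, IsMoveUp la mu t.1 t.2.1 t.2.2 then
      moveCoeff la h.choose.1 h.choose.2.1 h.choose.2.2
    else if la = mu then e' la else 0

/-! The coefficient `r_{λμ}` is well defined. -/

theorem row_anti (la : n.Partition) {i j : ℕ} (h : i ≤ j) : row la j ≤ row la i := by
  unfold row
  have hs : (la.parts.sort (· ≥ ·)).Pairwise (· ≥ ·) := Multiset.pairwise_sort _ _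
  set l := la.parts.sort (· ≥ ·)
  by_cases hj : j < l.length
  · rw [List.getD_eq_getElem _ _ hj, List.getD_eq_getElem _ _ (lt_of_le_of_lt h hj)]
    rcases h.eq_or_lt with rfl | h
    · exact le_rfl
    · exact List.pairwise_iff_getElem.1 hs i j _ hj h
  · rw [List.getD_eq_default _ _ (not_lt.1 hj)]
    exact Nat.zero_le _

theorem parts_eq_map_row (la : n.Partition) :
    la.parts = (Multiset.range (len la)).map (row la) := by
  have h1 : len la = (la.parts.sort (· ≥ ·)).length := by simp [len]
  have h2 : (la.parts.sort (· ≥ ·) : Multiset ℕ) = la.parts := Multiset.sort_eq _ _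
  unfold row
  rw [h1]
  conv_lhs => rw [← h2]
  rw [Multiset.range, Multiset.map_coe]
  congr 1
  apply List.ext_getElem
  · simp
  · intro i hi _
    rw [List.getElem_map, List.getElem_range, List.getD_eq_getElem _ _ hi]

theorem lt_len_of_row_pos (la : n.Partition) {j : ℕ} (h : 0 < row la j) : j < len la := by
  by_contra hj
  have h1 : len la = (la.parts.sort (· ≥ ·)).length := by simp [len]
  rw [h1] at hj
  unfold row at h
  rw [List.getD_eq_default _ _ (not_lt.1 hj)] at h
  exact absurd h (lt_irrefl _)

theorem isMoveUp_parts {la mu : n.Partition} {i j k : ℕ} (h : IsMoveUp la mu i j k) :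
    mu.parts + {row la i, row la j} =
      la.parts + {row la i + k} + Multiset.filter (· ≠ 0) {row la j - k} := by
  obtain ⟨hij, hk, hkj, hmu⟩ := h
  have hj : j < len la := lt_len_of_row_pos la (lt_of_lt_of_le hk hkj)
  have hi : i < len la := hij.trans hj
  obtain ⟨s, hs⟩ := Multiset.exists_cons_of_mem (Multiset.mem_range.2 hi)
  have hjs : j ∈ s := by
    have : j ∈ Multiset.range (len la) := Multiset.mem_range.2 hj
    rw [hs, Multiset.mem_cons] at this
    exact this.resolve_left hij.ne'
  obtain ⟨t, ht⟩ := Multiset.exists_cons_of_mem hjs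
  have hnd := Multiset.nodup_range (len la)
  rw [hs, ht] at hnd
  simp only [Multiset.nodup_cons, Multiset.mem_cons, not_or] at hnd
  obtain ⟨⟨_, hit⟩, hjt, _⟩ := hnd
  have hrest : t.map (movedRow la i j k) = t.map (row la) := by
    apply Multiset.map_congr rfl
    intro x hx
    have h1 : x ≠ i := fun h => hit (h ▸ hx)
    have h2 : x ≠ j := fun h => hjt (h ▸ hx)
    simp [movedRow, h1, h2]
  have hla : la.parts = row la i ::ₘ row la j ::ₘ t.map (row la) := by
    rw [parts_eq_map_row, hs, ht]; simp
  have hpos : (t.map (row la)).filter (· ≠ 0) = t.map (row la) := by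
    rw [Multiset.filter_eq_self]
    intro a ha
    have : a ∈ la.parts := by rw [hla]; simp [Multiset.mem_cons] at ha ⊢; exact Or.inr (Or.inr ha)
    exact (la.parts_pos this).ne'
  have hmi : movedRow la i j k i = row la i + k := by simp [movedRow]
  have hmj : movedRow la i j k j = row la j - k := by simp [movedRow, hij.ne']
  rw [hmu, hla, hs, ht]
  rw [Multiset.map_cons, Multiset.map_cons, hrest, hmi, hmj, ← Multiset.singleton_add,
    ← Multiset.singleton_add (row la j - k), Multiset.filter_add, Multiset.filter_add, hpos]
  have h3 : Multiset.filter (· ≠ 0) {row la i + k} = {row la i + k} := by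
    rw [Multiset.filter_eq_self]; intro a ha; rw [Multiset.mem_singleton] at ha; omega
  rw [h3]
  simp only [← Multiset.singleton_add, Multiset.insert_eq_cons]
  abel

theorem isMoveUp_unique {la mu : n.Partition} {i j k i' j' k' : ℕ}
    (h : IsMoveUp la mu i j k) (h' : IsMoveUp la mu i' j' k') :
    row la i = row la i' ∧ row la j = row la j' ∧ k = k' := by
  have e1 := isMoveUp_parts h
  have e2 := isMoveUp_parts h'
  have hab := row_anti la h.1.le
  have hab' := row_anti la h'.1.le
  have hk := h.2.1
  have hk' := h'.2.1
  have hkb := h.2.2.1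
  have hkb' := h'.2.2.1
  generalize row la i = a at *
  generalize row la j = b at *
  generalize row la i' = a' at *
  generalize row la j' = b' at *
  have key : ({a + k} + Multiset.filter (· ≠ 0) {b - k} + {a', b'} : Multiset ℕ) =
      {a' + k'} + Multiset.filter (· ≠ 0) {b' - k'} + {a, b} := by
    have := congrArg₂ (· + ·) e1.symm e2
    apply add_left_cancel (a := la.parts + mu.parts)
    calc _ = la.parts + {a + k} + Multiset.filter (· ≠ 0) {b - k} + (mu.parts + {a', b'}) := by
          abel
      _ = _ := this
      _ = _ := by abel
  have hm : ∀ x : ℕ, (x = a + k ∨ (x = b - k ∧ x ≠ 0) ∨ x = a' ∨ x = b') ↔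
      (x = a' + k' ∨ (x = b' - k' ∧ x ≠ 0) ∨ x = a ∨ x = b) := by
    intro x
    have := congrArg (fun s : Multiset ℕ => x ∈ s) key
    simp only [Multiset.mem_add, Multiset.mem_filter, Multiset.mem_singleton,
      Multiset.insert_eq_cons, Multiset.mem_cons, or_assoc] at this
    exact iff_of_eq this
  have s1 := (hm (a + k)).1 (Or.inl rfl)
  have s2 := (hm (a' + k')).2 (Or.inl rfl)
  have s3 := (hm a).2 (Or.inr (Or.inr (Or.inl rfl)))
  have s4 := (hm a').1 (Or.inr (Or.inr (Or.inl rfl)))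
  have s5 := (hm b).2 (Or.inr (Or.inr (Or.inr rfl)))
  have s6 := (hm b').1 (Or.inr (Or.inr (Or.inr rfl)))
  have hak : a + k = a' + k' := by omega
  have haa : a = a' := by omega
  subst haa
  have hkk : k = k' := by omega
  subst hkk
  have key2 : Multiset.filter (· ≠ 0) ({b - k} : Multiset ℕ) + {b'} =
      Multiset.filter (· ≠ 0) {b' - k} + {b} := by
    apply add_left_cancel (a := ({a + k} + {a} : Multiset ℕ))
    simp only [Multiset.insert_eq_cons, ← Multiset.singleton_add] at key
    calc _ = {a + k} + Multiset.filter (· ≠ 0) {b - k} + ({a} + {b'}) := by abel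
      _ = _ := key
      _ = _ := by abel
  have hm2 : ∀ x : ℕ, ((x = b - k ∧ x ≠ 0) ∨ x = b') ↔ ((x = b' - k ∧ x ≠ 0) ∨ x = b) := by
    intro x
    have := congrArg (fun s : Multiset ℕ => x ∈ s) key2
    simpa using this
  have t1 := (hm2 b).2 (Or.inr rfl)
  have t2 := (hm2 b').1 (Or.inr rfl)
  exact ⟨rfl, by omega, rfl⟩

/-- `r_{λμ}` is given by the formula for every moving up operator taking `λ` to `μ`. -/
theorem r_eq_of_isMoveUp {la mu : n.Partition} {i j k : ℕ} (h : IsMoveUp la mu i j k) :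
    r la mu = moveCoeff la i j k := by
  have hex : ∃ t : ℕ × ℕ × ℕ, IsMoveUp la mu t.1 t.2.1 t.2.2 := ⟨(i, j, k), h⟩
  obtain ⟨h1, h2, h3⟩ := isMoveUp_unique hex.choose_spec h
  unfold r
  rw [dif_pos hex]
  unfold moveCoeff
  rw [h1, h2, h3]

end Recursion

end Jack

namespace Jack

open MvPolynomial

/-! The recursion is the eigenvector equation of a Laplace–Beltrami operator `E` (`lb`), read off
coefficient by coefficient in the `q_μ`. In power sums, `2αE` has the terms `p_{i+j} p_i^⊥ p_j^⊥`,
`p_i p_j p_{i+j}^⊥` and `(α-1)(k-1) p_k p_k^⊥`, where `p_k^⊥ = α k ∂/∂p_k` is adjoint to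
multiplication by `p_k`. Adjunction exchanges the first two families and fixes the third, so `E` is
self-adjoint (`jackForm_lb`).

On the one-row functions `p_k^⊥ Q_m = Q_{m-k}`, and Newton's identity `∑ p_k Q_{m-k} = α m Q_m`
holds. Hence each `Q_m` is an eigenvector (`lb_qInt`). Since `E` has order two, on a product it acts
on the single factors and, through `cross`, on pairs of factors; for a pair `Q_a Q_b` a telescoping
argument (`cross_qOne`) produces the products `Q_{a+k} Q_{b-k}` with coefficients `a-b+2k`.
Collecting equal terms gives `lb_q`: `E` is triangular on the `q_λ`, with off-diagonal entries
`r_{λμ}` and diagonal entries `e'_λ` plus a constant depending only on `n`.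

The `q_λ` are dual to the monomial functions (`coeff_realize`), so the triangularity of `P_λ` in the
`m_μ` with `μ ≤ λ` becomes triangularity of `Q_λ` in the `q_μ` with `μ ≥ λ`
(`IsJackFamily.dualJack_mem_qSpan`). As `E` preserves this filtration and is self-adjoint,
orthogonality forces every `Q_λ` to be an eigenvector (`IsJackFamily.lb_dualJack`). Pairing the
eigenvector equation with the functional dual to `q_μ` yields the recursion. Its denominator is
non-zero because `∑ i λ_i` strictly decreases along strict dominance, which is visible at `α = 0`.
-/

/-! ### Coefficients of the one-row functions -/

/-- The weight `∑ k d_k` of an exponent vector, i.e. the degree of `∏ p_k ^ d_k`. -/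
noncomputable abbrev wt : (ℕ+ →₀ ℕ) →+ ℕ := Finsupp.weight (fun k : ℕ+ => (k : ℕ))

/-- The square norm of `∏ p_k ^ d_k` for the Jack scalar product. -/
noncomputable def normSq (d : ℕ+ →₀ ℕ) : F :=
  d.prod fun k m => α ^ m * ((k : ℕ) : F) ^ m * (m.factorial : F)

theorem alpha_ne_zero : α ≠ 0 := RatFunc.X_ne_zero

theorem normSq_zero : normSq 0 = 1 := Finsupp.prod_zero_index

theorem normSq_ne_zero (d : ℕ+ →₀ ℕ) : normSq d ≠ 0 := by
  refine Finset.prod_ne_zero_iff.2 fun k _ => mul_ne_zero (mul_ne_zero ?_ ?_) ?_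
  · exact pow_ne_zero _ alpha_ne_zero
  · exact pow_ne_zero _ (Nat.cast_ne_zero.2 k.ne_zero)
  · exact Nat.cast_ne_zero.2 (Nat.factorial_ne_zero _)

/-- The new factor is what differentiation by `p_k`, scaled by `α k`, produces; this makes that
derivation the adjoint of multiplication by `p_k`. -/
theorem normSq_add_single (d : ℕ+ →₀ ℕ) (k : ℕ+) :
    normSq (d + Finsupp.single k 1) = normSq d * (α * ((k : ℕ) : F) * ((d k : F) + 1)) := by
  have hs : (d + Finsupp.single k 1).support ⊆ insert k d.support := by
    intro x hx
    rw [Finset.mem_insert, Finsupp.mem_support_iff]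
    by_contra h
    push Not at h
    rw [Finsupp.mem_support_iff, Finsupp.add_apply, Finsupp.single_eq_of_ne h.1, h.2] at hx
    exact hx rfl
  unfold normSq
  rw [Finsupp.prod_of_support_subset _ hs _ (by simp),
    Finsupp.prod_of_support_subset d (Finset.subset_insert k _) _ (by simp),
    ← Finset.mul_prod_erase _ _ (Finset.mem_insert_self k d.support),
    ← Finset.mul_prod_erase _ _ (Finset.mem_insert_self k d.support)]
  have : ∀ x ∈ (insert k d.support).erase k, (d + Finsupp.single k 1 : ℕ+ →₀ ℕ) x = d x := by
    intro x hx
    rw [Finsupp.add_apply, Finsupp.single_eq_of_ne (Finset.ne_of_mem_erase hx), add_zero]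
  rw [Finset.prod_congr rfl (fun x hx => by rw [this x hx])]
  rw [Finsupp.add_apply, Finsupp.single_eq_same, Nat.factorial_succ]
  push_cast
  ring

/-- The exponent vector of `p_λ`. -/
noncomputable def expo {n : ℕ} (la : n.Partition) : ℕ+ →₀ ℕ :=
  Multiset.toFinsupp (la.parts.map Nat.toPNat')

theorem map_coe_map_toPNat' {n : ℕ} (la : n.Partition) :
    (la.parts.map Nat.toPNat').map (fun k : ℕ+ => (k : ℕ)) = la.parts := by
  rw [Multiset.map_map]
  conv_rhs => rw [← Multiset.map_id' la.parts]
  refine Multiset.map_congr rfl fun x hx => ?_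
  simp [Nat.toPNat'_coe, la.parts_pos hx]

theorem pPart_eq_monomial {n : ℕ} (la : n.Partition) : pPart la = monomial (expo la) 1 := by
  unfold pPart expo
  induction la.parts using Multiset.induction_on with
  | empty => simp
  | cons a s ih =>
    rw [Multiset.map_cons, Multiset.prod_cons, ih, Multiset.map_cons, ← Multiset.singleton_add,
      map_add, Multiset.toFinsupp_singleton, X, monomial_mul, one_mul]

theorem wt_toFinsupp (s : Multiset ℕ+) :
    wt (Multiset.toFinsupp s) = (s.map (fun k : ℕ+ => (k : ℕ))).sum := by
  induction s using Multiset.induction_on with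
  | empty => simp
  | cons a s ih =>
    rw [← Multiset.singleton_add, map_add, map_add, Multiset.toFinsupp_singleton, ih,
      Finsupp.weight_single]
    simp

theorem wt_expo {n : ℕ} (la : n.Partition) : wt (expo la) = n := by
  rw [expo, wt_toFinsupp, map_coe_map_toPNat', la.parts_sum]

theorem expo_injective {n : ℕ} : Function.Injective (expo (n := n)) := by
  intro la mu h
  have := Multiset.toFinsupp.injective h
  apply Nat.Partition.ext
  rw [← map_coe_map_toPNat' la, this, map_coe_map_toPNat']

theorem exists_expo_eq {n : ℕ} {d : ℕ+ →₀ ℕ} (h : wt d = n) : ∃ la : n.Partition, expo la = d := by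
  have hd : Multiset.toFinsupp (Finsupp.toMultiset d) = d := Finsupp.toMultiset_toFinsupp d
  refine ⟨⟨(Finsupp.toMultiset d).map (fun k : ℕ+ => (k : ℕ)), ?_, ?_⟩, ?_⟩
  · intro i hi
    obtain ⟨k, _, rfl⟩ := Multiset.mem_map.1 hi
    exact k.pos
  · rw [← wt_toFinsupp, hd, h]
  · rw [expo]
    conv_rhs => rw [← hd]
    rw [Multiset.map_map]
    congr 1
    conv_rhs => rw [← Multiset.map_id' (Finsupp.toMultiset d)]
    exact Multiset.map_congr rfl fun x _ => by simp

theorem normSq_expo {n : ℕ} (la : n.Partition) :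
    normSq (expo la) = α ^ len la * ((zee la : ℕ) : F) := by
  have hc : ∀ a ∈ la.parts, expo la a.toPNat' = mult la a := by
    intro a ha
    rw [expo, Multiset.toFinsupp_apply, mult]
    conv_rhs => rw [← map_coe_map_toPNat' la]
    rw [← Multiset.count_map_eq_count' (fun k : ℕ+ => (k : ℕ)) _ PNat.coe_injective]
    simp [Nat.toPNat'_coe, la.parts_pos ha]
  have h1 : normSq (expo la) =
      ∏ a ∈ la.parts.toFinset, (α ^ mult la a * (a : F) ^ mult la a * ((mult la a).factorial : F)) := by
    unfold normSq Finsupp.prod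
    symm
    refine Finset.prod_bij (fun a _ => a.toPNat') ?_ ?_ ?_ ?_
    · intro a ha
      rw [Multiset.mem_toFinset] at ha
      rw [Finsupp.mem_support_iff, hc a ha]
      exact (Multiset.count_pos.2 ha).ne'
    · intro a ha b hb hab
      rw [Multiset.mem_toFinset] at ha hb
      have := congrArg (fun k : ℕ+ => (k : ℕ)) hab
      simpa [Nat.toPNat'_coe, la.parts_pos ha, la.parts_pos hb] using this
    · intro b hb
      rw [expo, Multiset.toFinsupp_support, Multiset.mem_toFinset, Multiset.mem_map] at hb
      obtain ⟨a, ha, rfl⟩ := hb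
      exact ⟨a, Multiset.mem_toFinset.2 ha, rfl⟩
    · intro a ha
      rw [Multiset.mem_toFinset] at ha
      rw [hc a ha]
      simp [Nat.toPNat'_coe, la.parts_pos ha]
  rw [h1, zee]
  simp only [mul_assoc]
  rw [Finset.prod_mul_distrib, Finset.prod_pow_eq_pow_sum]
  congr 1
  · congr 1
    exact Multiset.toFinset_sum_count_eq la.parts
  · push_cast
    rfl

/-- Partitions of `m` correspond bijectively to exponent vectors of weight `m`, so a single summand
contributes. With inverse square norms as coefficients, `Q_m` pairs to `1` with every power-sum
monomial of degree `m`. -/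
theorem coeff_qOne (m : ℕ) (d : ℕ+ →₀ ℕ) :
    coeff d (qOne m) = if wt d = m then (normSq d)⁻¹ else 0 := by
  have h1 : coeff d (qOne m) =
      ∑ la : m.Partition, if expo la = d then (normSq d)⁻¹ else 0 := by
    rw [qOne, coeff_sum]
    refine Finset.sum_congr rfl fun la _ => ?_
    rw [coeff_smul, pPart_eq_monomial, coeff_monomial, smul_eq_mul, ← mul_inv, ← normSq_expo]
    split_ifs with h
    · rw [h, mul_one]
    · rw [mul_zero]
  rw [h1]
  split_ifs with h
  · obtain ⟨la, rfl⟩ := exists_expo_eq h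
    rw [Finset.sum_eq_single la]
    · simp
    · intro mu _ hmu
      rw [if_neg fun h => hmu (expo_injective h)]
    · simp
  · refine Finset.sum_eq_zero fun la _ => if_neg ?_
    rintro rfl
    exact h (wt_expo la)

theorem qOne_isWeightedHomogeneous (m : ℕ) :
    IsWeightedHomogeneous (fun k : ℕ+ => (k : ℕ)) (qOne m) m := by
  intro d hd
  by_contra h
  rw [coeff_qOne] at hd
  exact hd (if_neg h)

theorem qOne_zero : qOne 0 = 1 := by
  ext d
  rw [coeff_qOne, coeff_one]
  have : wt d = 0 ↔ 0 = d := by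
    constructor
    · intro h
      ext k
      by_contra hk
      have := Finsupp.le_weight (fun k : ℕ+ => (k : ℕ)) (s := k) k.ne_zero d
      rw [h] at this
      have h3 : d k ≠ 0 := fun h => hk (by simp [h])
      omega
    · rintro rfl
      simp
  simp only [this]
  split_ifs with h
  · rw [← h, normSq_zero, inv_one]
  · rfl

/-! ### Adjoints of the power sums and Newton's identity -/

/-- `p_{k+1}`. -/
noncomputable def pp (k : ℕ) : Sym := X k.succPNat

/-- The derivation `p_{k+1}^⊥ = α (k+1) ∂/∂p_{k+1}`. -/
noncomputable def pd (k : ℕ) : Derivation F Sym Sym := (α * ((k : F) + 1)) • pderiv k.succPNat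

theorem coeff_pd (k : ℕ) (f : Sym) (d : ℕ+ →₀ ℕ) :
    coeff d (pd k f) = α * ((k : F) + 1) * ((d k.succPNat : F) + 1) *
      coeff (d + Finsupp.single k.succPNat 1) f := by
  rw [pd, Derivation.smul_apply, coeff_smul, coeff_pderiv, smul_eq_mul]
  ring

theorem pd_comm (i j : ℕ) (f : Sym) : pd i (pd j f) = pd j (pd i f) := by
  ext d
  simp only [coeff_pd]
  rw [add_right_comm]
  by_cases h : i = j
  · subst h; ring
  · have h' : i.succPNat ≠ j.succPNat := fun e => h (Nat.succPNat_injective e)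
    simp only [Finsupp.add_apply, Finsupp.single_eq_of_ne h', Finsupp.single_eq_of_ne h'.symm]
    ring_nf

/-- The one-row function `Q_m`, for all integers `m`. -/
noncomputable def qInt (m : ℤ) : Sym := if 0 ≤ m then qOne m.toNat else 0

theorem qInt_natCast (m : ℕ) : qInt m = qOne m := by simp [qInt]

theorem qInt_of_neg {m : ℤ} (h : m < 0) : qInt m = 0 := if_neg (not_le.2 h)

theorem coeff_qInt (m : ℤ) (d : ℕ+ →₀ ℕ) :
    coeff d (qInt m) = if (wt d : ℤ) = m then (normSq d)⁻¹ else 0 := by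
  by_cases hm : 0 ≤ m
  · obtain ⟨k, rfl⟩ := Int.eq_ofNat_of_zero_le hm
    rw [qInt_natCast, coeff_qOne]
    simp only [Nat.cast_inj]
  · rw [qInt, if_neg hm, coeff_zero, if_neg]
    omega

/-- The factor brought down by the derivation cancels the growth of the square norm in
`normSq_add_single`. Integer indices cover the case of a negative new index, where both sides
vanish. -/
theorem pd_qInt (k : ℕ) (m : ℤ) : pd k (qInt m) = qInt (m - (k + 1)) := by
  ext d
  rw [coeff_pd, coeff_qInt, coeff_qInt, map_add, Finsupp.weight_single, normSq_add_single]
  have h1 : (((wt d + 1 • ((k.succPNat : ℕ+) : ℕ) : ℕ) : ℤ) = m) ↔ ((wt d : ℤ) = m - (k + 1)) := by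
    simp only [Nat.succPNat_coe, one_smul]
    push_cast
    omega
  simp only [h1]
  split_ifs
  · have h2 := normSq_ne_zero d
    have h3 : (k : F) + 1 ≠ 0 := Nat.cast_add_one_ne_zero k
    have h4 : (d k.succPNat : F) + 1 ≠ 0 := Nat.cast_add_one_ne_zero _
    have h5 := alpha_ne_zero
    simp only [Nat.succPNat_coe, Nat.succ_eq_add_one, Nat.cast_add, Nat.cast_one]
    field_simp
  · ring

/-- Multiplication by `p_{k+1}`, on coefficients. -/
theorem coeff_pp_mul (k : ℕ) (f : Sym) (d : ℕ+ →₀ ℕ) :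
    coeff d (pp k * f) =
      if d k.succPNat = 0 then 0 else coeff (d - Finsupp.single k.succPNat 1) f := by
  rw [pp, coeff_X_mul']
  simp only [Finsupp.mem_support_iff]
  split_ifs <;> simp_all

/-- Newton's identity for the `Q_m`. -/
theorem sum_pp_mul_qInt {N : ℕ} {m : ℤ} (h : m ≤ N) :
    ∑ i ∈ Finset.range N, pp i * qInt (m - (i + 1)) = (α * (m : F)) • qInt m := by
  -- Each `p_k p_k^⊥` is diagonal on monomials with eigenvalue `α k d_k`; summed over `k`, this is
  -- `α` times Euler's degree operator.
  have key : ∀ i : ℕ, ∀ d : ℕ+ →₀ ℕ, coeff d (pp i * pd i (qInt m)) =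
      α * ((i : F) + 1) * (d i.succPNat : F) * coeff d (qInt m) := by
    intro i d
    rw [coeff_pp_mul]
    split_ifs with h0
    · rw [h0]; simp
    · rw [coeff_pd]
      have hs : d - Finsupp.single i.succPNat 1 + Finsupp.single i.succPNat 1 = d := by
        ext x
        by_cases hx : x = i.succPNat
        · subst hx; simp; omega
        · simp [Finsupp.single_eq_of_ne hx]
      rw [hs, Finsupp.tsub_apply, Finsupp.single_eq_same, Nat.cast_sub (by omega)]
      push_cast
      ring
  simp only [← pd_qInt]
  ext d
  rw [coeff_sum, coeff_smul, smul_eq_mul]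
  simp only [key]
  rw [← Finset.sum_mul]
  by_cases hd : (wt d : ℤ) = m
  swap
  · rw [coeff_qInt, if_neg hd, mul_zero, mul_zero]
  congr 1
  -- This is where `m ≤ N` enters: no `p_k` with `k > N` occurs in a monomial of weight `m`.
  have hwt : wt d = ∑ i ∈ Finset.range N, (i + 1) * d i.succPNat := by
    rw [wt, Finsupp.weight_apply, Finsupp.sum_of_support_subset (s := (Finset.range N).map
      ⟨Nat.succPNat, Nat.succPNat_injective⟩) _ _ _ (by simp), Finset.sum_map]
    · refine Finset.sum_congr rfl fun i _ => ?_
      simp [mul_comm]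
    · intro k hk
      rw [Finset.mem_map]
      have h1 := Finsupp.le_weight_of_ne_zero' (fun k : ℕ+ => (k : ℕ)) (Finsupp.mem_support_iff.1 hk)
      refine ⟨k.natPred, ?_, by simp⟩
      rw [Finset.mem_range]
      have h2 : k.natPred + 1 = k := PNat.natPred_add_one k
      have h3 : (k : ℕ) ≤ wt d := h1
      omega
  rw [← hd, hwt]
  push_cast
  rw [Finset.mul_sum]
  exact Finset.sum_congr rfl fun i _ => by ring

/-! ### The scalar product -/

theorem scalarProduct_eq_sum {f : Sym} (g : Sym) {s : Finset (ℕ+ →₀ ℕ)} (h : f.support ⊆ s) :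
    scalarProduct f g = ∑ d ∈ s, f.coeff d * g.coeff d * normSq d := by
  refine Finset.sum_subset h fun d _ hd => ?_
  rw [notMem_support_iff.1 hd]
  ring

theorem scalarProduct_comm (f g : Sym) : scalarProduct f g = scalarProduct g f := by
  classical
  rw [scalarProduct_eq_sum g (Finset.subset_union_left (s₂ := g.support)),
    scalarProduct_eq_sum f (Finset.subset_union_right (s₁ := f.support))]
  exact Finset.sum_congr rfl fun d _ => by ring

theorem scalarProduct_add_right (f g h : Sym) :
    scalarProduct f (g + h) = scalarProduct f g + scalarProduct f h := by
  unfold scalarProduct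
  rw [← Finset.sum_add_distrib]
  refine Finset.sum_congr rfl fun d _ => ?_
  rw [coeff_add]
  ring

theorem scalarProduct_smul_right (c : F) (f g : Sym) :
    scalarProduct f (c • g) = c * scalarProduct f g := by
  unfold scalarProduct
  rw [Finset.mul_sum]
  refine Finset.sum_congr rfl fun d _ => ?_
  rw [coeff_smul, smul_eq_mul]
  ring

/-- The Jack scalar product as a bilinear map. -/
noncomputable def jackForm : Sym →ₗ[F] Sym →ₗ[F] F :=
  LinearMap.mk₂ F scalarProduct
    (fun f g h => by
      rw [scalarProduct_comm, scalarProduct_add_right, scalarProduct_comm h, scalarProduct_comm h])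
    (fun c f g => by
      rw [scalarProduct_comm, scalarProduct_smul_right, scalarProduct_comm g, smul_eq_mul])
    scalarProduct_add_right
    (fun c f g => by rw [scalarProduct_smul_right, smul_eq_mul])

theorem jackForm_apply (f g : Sym) : jackForm f g = scalarProduct f g := rfl

theorem jackForm_comm (f g : Sym) : jackForm f g = jackForm g f := scalarProduct_comm f g

theorem jackForm_monomial (d : ℕ+ →₀ ℕ) (a : F) (g : Sym) :
    jackForm (monomial d a) g = a * coeff d g * normSq d := by
  rw [jackForm_apply, scalarProduct_eq_sum g support_monomial_subset, Finset.sum_singleton,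
    coeff_monomial, if_pos rfl]

/-- Multiplication by `p_{k+1}` is adjoint to `p_{k+1}^⊥`. -/
theorem jackForm_pp_mul (k : ℕ) (f g : Sym) : jackForm (pp k * f) g = jackForm f (pd k g) := by
  induction f using MvPolynomial.induction_on' with
  | monomial d a =>
    rw [pp, X, monomial_mul, one_mul, add_comm, jackForm_monomial, jackForm_monomial, coeff_pd,
      normSq_add_single]
    simp only [Nat.succPNat_coe, Nat.succ_eq_add_one, Nat.cast_add, Nat.cast_one]
    ring
  | add f₁ f₂ h₁ h₂ =>
    rw [mul_add, map_add, map_add, LinearMap.add_apply, LinearMap.add_apply, h₁, h₂]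

theorem jackForm_eq_zero_of_isWeightedHomogeneous {f g : Sym} {m n : ℕ}
    (hf : IsWeightedHomogeneous (fun k : ℕ+ => (k : ℕ)) f m)
    (hg : IsWeightedHomogeneous (fun k : ℕ+ => (k : ℕ)) g n) (h : m ≠ n) : jackForm f g = 0 := by
  refine Finset.sum_eq_zero fun d _ => ?_
  by_cases hd : wt d = m
  · rw [hg.coeff_eq_zero d (hd.trans_ne h), mul_zero, zero_mul]
  · rw [hf.coeff_eq_zero d hd, zero_mul, zero_mul]

theorem eq_zero_of_jackForm_eq_zero {f : Sym} (h : ∀ g, jackForm g f = 0) : f = 0 := by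
  ext d
  have := h (monomial d 1)
  rw [jackForm_monomial, one_mul] at this
  exact (mul_eq_zero.1 this).resolve_right (normSq_ne_zero d)

/-! ### The products `q_d` are dual to the monomials -/

theorem derivation_prod {ι : Type*} [DecidableEq ι] (D : Derivation F Sym Sym) (s : Finset ι)
    (f : ι → Sym) : D (∏ i ∈ s, f i) = ∑ i ∈ s, (∏ j ∈ s.erase i, f j) * D (f i) := by
  induction s using Finset.induction_on with
  | empty => simp
  | insert a s ha ih =>
    rw [Finset.prod_insert ha, Derivation.leibniz, ih, Finset.sum_insert ha,
      Finset.erase_insert ha, smul_eq_mul, smul_eq_mul, add_comm, Finset.mul_sum]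
    congr 1
    refine Finset.sum_congr rfl fun i hi => ?_
    have hia : a ≠ i := fun h => ha (h ▸ hi)
    rw [Finset.erase_insert_of_ne hia, Finset.prod_insert (fun h => ha (Finset.mem_of_mem_erase h)),
      mul_assoc]

/-- `∏_i Q_{d_i}`. -/
noncomputable def qExp (d : ℕ →₀ ℕ) : Sym := d.prod fun _ m => qOne m

theorem qExp_eq_prod {d : ℕ →₀ ℕ} {s : Finset ℕ} (h : d.support ⊆ s) :
    qExp d = ∏ i ∈ s, qOne (d i) :=
  Finsupp.prod_of_support_subset _ h _ fun _ _ => qOne_zero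

/-- The Leibniz rule lowers one index at a time, the same pattern as in `coeff_powerSum_mul`; the
match of the two drives the induction in `coeff_realize`. -/
theorem pd_qExp (k : ℕ) (d : ℕ →₀ ℕ) : pd k (qExp d) =
    ∑ i ∈ d.support, if k + 1 ≤ d i then qExp (d - Finsupp.single i (k + 1)) else 0 := by
  rw [qExp, Finsupp.prod, derivation_prod]
  refine Finset.sum_congr rfl fun i hi => ?_
  rw [← qInt_natCast (d i), pd_qInt]
  split_ifs with h
  · have hs : (d - Finsupp.single i (k + 1)).support ⊆ d.support := by
      intro x hx
      rw [Finsupp.mem_support_iff, Finsupp.tsub_apply] at hx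
      rw [Finsupp.mem_support_iff]
      omega
    rw [qExp_eq_prod hs, ← Finset.prod_erase_mul _ _ hi, ← qInt_natCast ((d - _) i)]
    congr 1
    · refine Finset.prod_congr rfl fun j hj => ?_
      rw [Finsupp.tsub_apply, Finsupp.single_eq_of_ne (Finset.ne_of_mem_erase hj), Nat.sub_zero]
    · rw [Finsupp.tsub_apply, Finsupp.single_eq_same, Nat.cast_sub h]
      push_cast
      rfl
  · rw [qInt_of_neg (by omega), mul_zero]

theorem coeff_powerSum_mul (k : ℕ+) (f : MvPowerSeries ℕ F) (d : ℕ →₀ ℕ) :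
    MvPowerSeries.coeff d (powerSum k * f) = ∑ i ∈ d.support,
      if (k : ℕ) ≤ d i then MvPowerSeries.coeff (d - Finsupp.single i (k : ℕ)) f else 0 := by
  classical
  have hc : ∀ e, MvPowerSeries.coeff e (powerSum k) =
      if ∃ i : ℕ, e = Finsupp.single i (k : ℕ) then (1 : F) else 0 := by
    intro e
    change powerSum k e = _
    unfold powerSum
    congr
  rw [MvPowerSeries.coeff_mul]
  simp only [hc, ite_mul, one_mul, zero_mul]
  rw [← Finset.sum_filter, ← Finset.sum_filter]
  symm
  refine Finset.sum_bij (fun i _ => (Finsupp.single i (k : ℕ), d - Finsupp.single i (k : ℕ)))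
    ?_ ?_ ?_ ?_
  · intro i hi
    rw [Finset.mem_filter] at hi ⊢
    rw [Finset.HasAntidiagonal.mem_antidiagonal]
    exact ⟨add_tsub_cancel_of_le (Finsupp.single_le_iff.2 hi.2), i, rfl⟩
  · intro i _ j _ h
    have := congrArg Prod.fst h
    exact (Finsupp.single_left_inj k.ne_zero).1 this
  · rintro ⟨a, b⟩ h
    rw [Finset.mem_filter, Finset.HasAntidiagonal.mem_antidiagonal] at h
    obtain ⟨h1, i, hi⟩ := h
    simp only at h1 hi
    subst hi
    have hki : (k : ℕ) ≤ d i := by rw [← h1]; simp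
    refine ⟨i, ?_, ?_⟩
    · rw [Finset.mem_filter, Finsupp.mem_support_iff]
      exact ⟨by have := k.pos; omega, hki⟩
    · simp [← h1]
  · intro i _
    rfl

theorem constantCoeff_qOne (m : ℕ) : constantCoeff (qOne m) = if m = 0 then 1 else 0 := by
  rw [constantCoeff_eq, coeff_qOne, map_zero, normSq_zero, inv_one]
  simp only [eq_comm]

/-- Taking the coefficient of `x^d` is the scalar product with `∏_i Q_{d_i}`. -/
theorem coeff_realize (f : Sym) (d : ℕ →₀ ℕ) :
    MvPowerSeries.coeff d (realize f) = jackForm f (qExp d) := by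
  classical
  induction f using MvPolynomial.induction_on generalizing d with
  | C a =>
    rw [← algebraMap_eq, AlgHom.commutes, MvPowerSeries.algebraMap_apply, Algebra.algebraMap_self,
      RingHom.id_apply, MvPowerSeries.coeff_C, algebraMap_eq, C_apply, jackForm_monomial, normSq_zero,
      mul_one, ← constantCoeff_eq, qExp, Finsupp.prod, map_prod]
    split_ifs with h
    · subst h; simp
    · obtain ⟨i, hi⟩ := Finsupp.support_nonempty_iff.2 h
      rw [Finset.prod_eq_zero hi, mul_zero]
      rw [constantCoeff_qOne, if_neg (Finsupp.mem_support_iff.1 hi)]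
  | add f g hf hg => rw [map_add, map_add, map_add, LinearMap.add_apply, hf, hg]
  | mul_X f k hf =>
    have hk : (X k : Sym) = pp k.natPred := by rw [pp, PNat.succPNat_natPred]
    rw [mul_comm, map_mul, hk, jackForm_pp_mul, pd_qExp, map_sum, ← hk, realize, aeval_X, ← realize,
      coeff_powerSum_mul]
    refine Finset.sum_congr rfl fun i _ => ?_
    rw [PNat.natPred_add_one]
    split_ifs
    · rw [hf]
    · rw [map_zero]

/-! ### The products `q_d` span -/

/-- The span is a subalgebra, since products of `Q`'s are again such products, and it contains every
power sum because Newton's identity expresses them recursively. -/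
theorem span_qExp : Submodule.span F (Set.range qExp) = ⊤ := by
  have hadd : ∀ d e : ℕ →₀ ℕ, ∃ c, qExp d * qExp e = qExp c := by
    intro d e
    -- Shifting the positions of `e` by `N` makes the supports disjoint without changing its
    -- product, as that depends only on the exponents.
    obtain ⟨N, hN⟩ : ∃ N, ∀ i ∈ d.support, i < N :=
      ⟨d.support.sup id + 1, fun i hi => Nat.lt_succ_of_le (Finset.le_sup (f := id) hi)⟩
    refine ⟨d + e.mapDomain (· + N), ?_⟩
    have hinj : Function.Injective (· + N) := add_left_injective N
    have hdisj : Disjoint d.support (e.mapDomain (· + N)).support := by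
      rw [Finset.disjoint_left]
      intro i hi hi'
      rw [Finsupp.mapDomain_support_of_injective hinj, Finset.mem_image] at hi'
      obtain ⟨j, _, rfl⟩ := hi'
      have := hN _ hi
      omega
    unfold qExp
    rw [Finsupp.prod_add_index_of_disjoint hdisj, Finsupp.prod_mapDomain_index_inj hinj]
  have hone : (1 : Sym) ∈ Submodule.span F (Set.range qExp) :=
    Submodule.subset_span ⟨0, by simp [qExp]⟩
  have hmul : ∀ f ∈ Submodule.span F (Set.range qExp), ∀ g ∈ Submodule.span F (Set.range qExp),
      f * g ∈ Submodule.span F (Set.range qExp) := by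
    intro f hf g hg
    have := Submodule.mul_mem_mul hf hg
    rw [Submodule.span_mul_span] at this
    refine Submodule.span_mono ?_ this
    rintro _ ⟨_, ⟨d, rfl⟩, _, ⟨e, rfl⟩, rfl⟩
    obtain ⟨c, hc⟩ := hadd d e
    exact ⟨c, hc.symm⟩
  have hq : ∀ m : ℤ, qInt m ∈ Submodule.span F (Set.range qExp) := by
    intro m
    by_cases hm : 0 ≤ m
    · obtain ⟨k, rfl⟩ := Int.eq_ofNat_of_zero_le hm
      refine Submodule.subset_span ⟨Finsupp.single 0 k, ?_⟩
      rw [qExp, Finsupp.prod_single_index qOne_zero, qInt_natCast]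
    · rw [qInt_of_neg (by omega)]
      exact Submodule.zero_mem _
  have hp : ∀ k, pp k ∈ Submodule.span F (Set.range qExp) := by
    intro k
    induction k using Nat.strong_induction_on with
    | _ k ih =>
      -- At this degree the last term is `p_{k+1} Q_0 = p_{k+1}`, and the other terms involve only
      -- smaller power sums.
      have h := sum_pp_mul_qInt (N := k + 1) (m := k + 1) (by push_cast; rfl)
      have h0 : qInt 0 = 1 := by rw [← qOne_zero, ← qInt_natCast]; rfl
      rw [Finset.sum_range_succ, sub_self, h0, mul_one] at h
      rw [eq_sub_of_add_eq' h]
      refine Submodule.sub_mem _ (Submodule.smul_mem _ _ (hq _)) (Submodule.sum_mem _ ?_)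
      intro i hi
      exact hmul _ (ih i (Finset.mem_range.1 hi)) _ (hq _)
  rw [eq_top_iff]
  rintro f -
  induction f using MvPolynomial.induction_on with
  | C a =>
    rw [← algebraMap_eq, Algebra.algebraMap_eq_smul_one]
    exact Submodule.smul_mem _ _ hone
  | add f g hf hg => exact Submodule.add_mem _ hf hg
  | mul_X f k hf =>
    refine hmul _ hf _ ?_
    have := hp k.natPred
    rwa [pp, PNat.succPNat_natPred] at this

theorem eq_zero_of_jackForm_qExp_eq_zero {f : Sym} (h : ∀ d, jackForm f (qExp d) = 0) : f = 0 := by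
  refine eq_zero_of_jackForm_eq_zero fun g => ?_
  rw [jackForm_comm]
  have hg : g ∈ Submodule.span F (Set.range qExp) := span_qExp ▸ Submodule.mem_top
  have : Submodule.span F (Set.range qExp) ≤ LinearMap.ker (jackForm f) := by
    rw [Submodule.span_le]
    rintro _ ⟨d, rfl⟩
    exact h d
  exact this hg

/-! ### The Laplace–Beltrami operator -/

/-- The terms of the Laplace–Beltrami operator, scaled by `2α`, with `p_i`, `p_j`, `i, j ≤ N`. -/
noncomputable def lbScaled (N : ℕ) : Sym →ₗ[F] Sym :=
  (∑ i ∈ Finset.range N, ∑ j ∈ Finset.range N,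
    (LinearMap.mulLeft F (pp (i + j + 1)) ∘ₗ (pd i).toLinearMap ∘ₗ (pd j).toLinearMap +
      LinearMap.mulLeft F (pp i) ∘ₗ LinearMap.mulLeft F (pp j) ∘ₗ (pd (i + j + 1)).toLinearMap)) +
  (α - 1) • ∑ k ∈ Finset.range N, (k : F) • LinearMap.mulLeft F (pp k) ∘ₗ (pd k).toLinearMap

theorem lbScaled_apply (N : ℕ) (f : Sym) : lbScaled N f =
    (∑ i ∈ Finset.range N, ∑ j ∈ Finset.range N,
      (pp (i + j + 1) * pd i (pd j f) + pp i * (pp j * pd (i + j + 1) f))) +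
    (α - 1) • ∑ k ∈ Finset.range N, (k : F) • (pp k * pd k f) := by
  simp [lbScaled, LinearMap.sum_apply]

/-- The Laplace–Beltrami operator, truncated at `N`; on symmetric functions of degree at most `N`
the truncation has no effect. -/
noncomputable def lb (N : ℕ) : Sym →ₗ[F] Sym := (2 * α)⁻¹ • lbScaled N

theorem jackForm_mul_pp (k : ℕ) (f g : Sym) : jackForm f (pp k * g) = jackForm (pd k f) g := by
  rw [jackForm_comm, jackForm_pp_mul, jackForm_comm]

/-- Taking adjoints swaps the two families of terms for each pair `(i, j)` and fixes each `p_k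
p_k^⊥`, so the truncated operator is already self-adjoint. -/
theorem jackForm_lb (N : ℕ) (f g : Sym) : jackForm (lb N f) g = jackForm f (lb N g) := by
  have h1 : ∀ i j, jackForm (pp (i + j + 1) * pd i (pd j f) + pp i * (pp j * pd (i + j + 1) f)) g =
      jackForm f (pp (i + j + 1) * pd i (pd j g) + pp i * (pp j * pd (i + j + 1) g)) := by
    intro i j
    rw [map_add, map_add, LinearMap.add_apply, jackForm_pp_mul, jackForm_pp_mul, jackForm_pp_mul,
      jackForm_mul_pp, jackForm_mul_pp, jackForm_mul_pp, pd_comm j i g, pd_comm j i f, add_comm]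
  have h2 : ∀ k, jackForm (pp k * pd k f) g = jackForm f (pp k * pd k g) := by
    intro k
    rw [jackForm_pp_mul, jackForm_mul_pp]
  have h : jackForm (lbScaled N f) g = jackForm f (lbScaled N g) := by
    rw [lbScaled_apply, lbScaled_apply, map_add, map_add, LinearMap.add_apply, map_smul, map_smul,
      LinearMap.smul_apply]
    simp only [map_sum, LinearMap.sum_apply, h1, map_smul, LinearMap.smul_apply, h2]
  rw [lb, LinearMap.smul_apply, LinearMap.smul_apply, map_smul, map_smul, LinearMap.smul_apply, h]

/-- The polarization of the second order part of the Laplace–Beltrami operator. -/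
noncomputable def cross (N : ℕ) (f g : Sym) : Sym :=
  α⁻¹ • ∑ i ∈ Finset.range N, ∑ j ∈ Finset.range N, pp (i + j + 1) * (pd i f * pd j g)

/-- Only the second-order terms fail the Leibniz rule. Their two mixed terms agree after exchanging
`i` and `j`, and the resulting `2` cancels against the scaling by `2α`. -/
theorem lb_mul (N : ℕ) (f g : Sym) : lb N (f * g) = lb N f * g + f * lb N g + cross N f g := by
  set A : Sym := ∑ i ∈ Finset.range N, ∑ j ∈ Finset.range N, pp (i + j + 1) * (pd i f * pd j g)
    with hA
  have hs : ∑ i ∈ Finset.range N, ∑ j ∈ Finset.range N, pp (i + j + 1) * (pd j f * pd i g) = A := by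
    rw [hA, Finset.sum_comm]
    refine Finset.sum_congr rfl fun i _ => Finset.sum_congr rfl fun j _ => ?_
    rw [add_comm j i]
  have h1 : ∀ i j, pp (i + j + 1) * pd i (pd j (f * g)) + pp i * (pp j * pd (i + j + 1) (f * g)) =
      (pp (i + j + 1) * pd i (pd j f) + pp i * (pp j * pd (i + j + 1) f)) * g +
      f * (pp (i + j + 1) * pd i (pd j g) + pp i * (pp j * pd (i + j + 1) g)) +
      (pp (i + j + 1) * (pd i f * pd j g) + pp (i + j + 1) * (pd j f * pd i g)) := by
    intro i j
    simp only [Derivation.leibniz, map_add, smul_eq_mul]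
    ring
  have h2 : ∀ k : ℕ, (k : F) • (pp k * pd k (f * g)) =
      ((k : F) • (pp k * pd k f)) * g + f * ((k : F) • (pp k * pd k g)) := by
    intro k
    have : pp k * pd k (f * g) = pp k * pd k f * g + f * (pp k * pd k g) := by
      rw [Derivation.leibniz, smul_eq_mul, smul_eq_mul]
      ring
    rw [this, smul_mul_assoc, mul_smul_comm, ← smul_add]
  have h3 : ∑ i ∈ Finset.range N, ∑ j ∈ Finset.range N,
      (pp (i + j + 1) * pd i (pd j (f * g)) + pp i * (pp j * pd (i + j + 1) (f * g))) =
      (∑ i ∈ Finset.range N, ∑ j ∈ Finset.range N,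
        (pp (i + j + 1) * pd i (pd j f) + pp i * (pp j * pd (i + j + 1) f))) * g +
      f * (∑ i ∈ Finset.range N, ∑ j ∈ Finset.range N,
        (pp (i + j + 1) * pd i (pd j g) + pp i * (pp j * pd (i + j + 1) g))) + (A + A) := by
    nth_rewrite 2 [← hs]
    simp only [hA, h1, Finset.sum_mul, Finset.mul_sum, ← Finset.sum_add_distrib]
  have h4 : ∑ k ∈ Finset.range N, (k : F) • (pp k * pd k (f * g)) =
      (∑ k ∈ Finset.range N, (k : F) • (pp k * pd k f)) * g +
      f * ∑ k ∈ Finset.range N, (k : F) • (pp k * pd k g) := by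
    simp only [h2, Finset.sum_mul, Finset.mul_sum, ← Finset.sum_add_distrib]
  have h : lbScaled N (f * g) = lbScaled N f * g + f * lbScaled N g + (A + A) := by
    rw [lbScaled_apply, lbScaled_apply, lbScaled_apply, h3, h4, smul_add, ← smul_mul_assoc,
      ← mul_smul_comm]
    ring
  have hc : cross N f g = α⁻¹ • A := rfl
  rw [lb, LinearMap.smul_apply, LinearMap.smul_apply, LinearMap.smul_apply, h, hc, smul_add,
    smul_add, smul_mul_assoc, mul_smul_comm, ← two_smul F A,
    smul_smul, mul_inv_rev, mul_assoc, inv_mul_cancel₀ two_ne_zero, mul_one]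

/-- For `k < N` there are exactly `k` pairs with `i + j + 1 = k`; the vanishing hypothesis disposes
of larger sums. -/
theorem sum_range_sum_range_add {M : Type*} [AddCommMonoid M] (u : ℕ → M) (N : ℕ)
    (h : ∀ k, N ≤ k → u k = 0) :
    ∑ i ∈ Finset.range N, ∑ j ∈ Finset.range N, u (i + j + 1) = ∑ k ∈ Finset.range N, k • u k := by
  have h1 : ∀ i ∈ Finset.range N, ∑ j ∈ Finset.range N, u (i + j + 1) =
      ∑ k ∈ Finset.range N, if i < k then u k else 0 := by
    intro i hi
    rw [Finset.mem_range] at hi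
    have e1 : ∑ k ∈ Finset.range (i + 1 + N), (if i < k then u k else 0) =
        ∑ k ∈ Finset.range N, if i < k then u k else 0 := by
      symm
      refine Finset.sum_subset (Finset.range_mono (by omega)) fun k _ hk => ?_
      rw [Finset.mem_range, not_lt] at hk
      rw [h k hk, ite_self]
    rw [← e1, Finset.sum_range_add]
    have e2 : ∑ k ∈ Finset.range (i + 1), (if i < k then u k else 0) = 0 := by
      refine Finset.sum_eq_zero fun k hk => ?_
      rw [Finset.mem_range] at hk
      rw [if_neg (by omega)]
    rw [e2, zero_add]
    refine Finset.sum_congr rfl fun j _ => ?_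
    rw [if_pos (by omega), add_right_comm]
  rw [Finset.sum_congr rfl h1, Finset.sum_comm]
  refine Finset.sum_congr rfl fun k hk => ?_
  rw [Finset.mem_range] at hk
  rw [← Finset.sum_filter, Finset.sum_const]
  congr 1
  have : (Finset.range N).filter (· < k) = Finset.range k := by
    ext x
    simp only [Finset.mem_filter, Finset.mem_range]
    omega
  rw [this, Finset.card_range]

/-- With `u k = p_{k+1} Q_{m-k-1}`, the three parts of the scaled operator contribute the
coefficients `k`, `α(m-k-1)` (by Newton's identity in degree `m-k-1`) and `(α-1)k`. Their sum
`α(m-1)` is independent of `k`, so Newton's identity in degree `m` finishes. -/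
theorem lb_qInt {N : ℕ} {m : ℤ} (h : m ≤ N) :
    lb N (qInt m) = (α * (m : F) * ((m : F) - 1) / 2) • qInt m := by
  set u : ℕ → Sym := fun k => pp k * qInt (m - (k + 1)) with hu
  have hN : ∑ i ∈ Finset.range N, u i = (α * (m : F)) • qInt m := sum_pp_mul_qInt h
  have h1 : ∑ i ∈ Finset.range N, ∑ j ∈ Finset.range N,
      pp (i + j + 1) * pd i (pd j (qInt m)) = ∑ k ∈ Finset.range N, (k : F) • u k := by
    have := sum_range_sum_range_add u N fun k hk => by
      simp only [hu]
      rw [qInt_of_neg (by omega), mul_zero]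
    simp only [Nat.cast_smul_eq_nsmul, ← this]
    refine Finset.sum_congr rfl fun i _ => Finset.sum_congr rfl fun j _ => ?_
    simp only [hu, pd_qInt]
    rw [show m - (((i + j + 1 : ℕ) : ℤ) + 1) = m - ((j : ℤ) + 1) - ((i : ℤ) + 1) by push_cast; ring]
  have h2 : ∑ i ∈ Finset.range N, ∑ j ∈ Finset.range N,
      pp i * (pp j * pd (i + j + 1) (qInt m)) =
      ∑ i ∈ Finset.range N, (α * ((m : F) - (i + 1))) • u i := by
    refine Finset.sum_congr rfl fun i _ => ?_
    have := sum_pp_mul_qInt (N := N) (m := m - (i + 1)) (by omega)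
    rw [← Finset.mul_sum, hu]
    simp only
    rw [← mul_smul_comm]
    congr 1
    push_cast at this
    rw [← this]
    refine Finset.sum_congr rfl fun j _ => ?_
    rw [pd_qInt]
    rw [show m - (((i + j + 1 : ℕ) : ℤ) + 1) = m - ((i : ℤ) + 1) - ((j : ℤ) + 1) by push_cast; ring]
  have hk : ∀ k, pp k * pd k (qInt m) = u k := fun k => by rw [pd_qInt]
  have hL : lbScaled N (qInt m) = (α * ((m : F) - 1)) • ∑ i ∈ Finset.range N, u i := by
    rw [lbScaled_apply]
    simp only [Finset.sum_add_distrib]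
    rw [h1, h2]
    simp only [hk]
    rw [Finset.smul_sum, Finset.smul_sum, ← Finset.sum_add_distrib, ← Finset.sum_add_distrib]
    refine Finset.sum_congr rfl fun i _ => ?_
    rw [smul_smul, ← add_smul, ← add_smul]
    congr 1
    ring
  rw [lb, LinearMap.smul_apply, hL, hN, smul_smul, smul_smul]
  congr 1
  have := alpha_ne_zero
  field_simp

/-- Both cross terms sum the same array `h`, one with its first index shifted and the other with its
second. They differ by the boundary row and column at index `0`, which Newton's identity evaluates;
the boundary at `N` vanishes because there an index of `Q` is negative. -/
theorem cross_qInt_step {N : ℕ} {a b : ℤ} (ha : a < N) (hb : b ≤ N) :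
    cross N (qInt a) (qInt b) = cross N (qInt (a + 1)) (qInt (b - 1)) +
      (((a : F) + 1) • (qInt (a + 1) * qInt (b - 1)) - (b : F) • (qInt a * qInt b)) := by
  set h : ℕ → ℕ → Sym := fun i j => pp (i + j) * (qInt (a - i) * qInt (b - 1 - j)) with hh
  have e1 : cross N (qInt a) (qInt b) =
      α⁻¹ • ∑ i ∈ Finset.range N, ∑ j ∈ Finset.range N, h (i + 1) j := by
    unfold cross
    refine congrArg _ (Finset.sum_congr rfl fun i _ => Finset.sum_congr rfl fun j _ => ?_)
    simp only [hh, pd_qInt]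
    rw [show i + 1 + j = i + j + 1 by ring, sub_sub b, add_comm (1 : ℤ), Nat.cast_succ]
  have e2 : cross N (qInt (a + 1)) (qInt (b - 1)) =
      α⁻¹ • ∑ i ∈ Finset.range N, ∑ j ∈ Finset.range N, h i (j + 1) := by
    unfold cross
    refine congrArg _ (Finset.sum_congr rfl fun i _ => Finset.sum_congr rfl fun j _ => ?_)
    simp only [hh, pd_qInt]
    rw [show i + (j + 1) = i + j + 1 by ring, add_sub_add_right_eq_sub, Nat.cast_succ]
  have t1 : ∑ i ∈ Finset.range N, ∑ j ∈ Finset.range N, h (i + 1) j +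
      ∑ j ∈ Finset.range N, h 0 j = ∑ i ∈ Finset.range N, ∑ j ∈ Finset.range N, h i j := by
    rw [Finset.sum_comm, Finset.sum_comm (f := h), ← Finset.sum_add_distrib]
    refine Finset.sum_congr rfl fun j _ => ?_
    rw [← Finset.sum_range_succ' (fun i => h i j), Finset.sum_range_succ]
    simp only [hh]
    rw [qInt_of_neg (m := a - N) (by omega), zero_mul, mul_zero, add_zero]
  have t2 : ∑ i ∈ Finset.range N, ∑ j ∈ Finset.range N, h i (j + 1) +
      ∑ i ∈ Finset.range N, h i 0 = ∑ i ∈ Finset.range N, ∑ j ∈ Finset.range N, h i j := by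
    rw [← Finset.sum_add_distrib]
    refine Finset.sum_congr rfl fun i _ => ?_
    rw [← Finset.sum_range_succ' (fun j => h i j), Finset.sum_range_succ]
    simp only [hh]
    rw [qInt_of_neg (m := b - 1 - N) (by omega), mul_zero, mul_zero, add_zero]
  have s1 : ∑ j ∈ Finset.range N, h 0 j = (α * (b : F)) • (qInt a * qInt b) := by
    rw [← mul_smul_comm, ← sum_pp_mul_qInt hb, Finset.mul_sum]
    refine Finset.sum_congr rfl fun j _ => ?_
    simp only [hh, Nat.cast_zero, sub_zero, zero_add]
    rw [mul_left_comm, sub_add_eq_sub_sub_swap]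
  have s2 : ∑ i ∈ Finset.range N, h i 0 =
      (α * ((a : F) + 1)) • (qInt (a + 1) * qInt (b - 1)) := by
    have := sum_pp_mul_qInt (N := N) (m := a + 1) (by omega)
    push_cast at this
    rw [← smul_mul_assoc, ← this, Finset.sum_mul]
    refine Finset.sum_congr rfl fun i _ => ?_
    simp only [hh, Nat.cast_zero, sub_zero, add_zero]
    rw [mul_assoc, add_sub_add_right_eq_sub]
  rw [e1, e2]
  have : ∑ i ∈ Finset.range N, ∑ j ∈ Finset.range N, h (i + 1) j =
      ∑ i ∈ Finset.range N, ∑ j ∈ Finset.range N, h i (j + 1) +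
        ((α * ((a : F) + 1)) • (qInt (a + 1) * qInt (b - 1)) -
          (α * (b : F)) • (qInt a * qInt b)) := by
    rw [← s1, ← s2, ← add_sub_assoc, t2, ← t1, add_sub_cancel_right]
  rw [this, smul_add, smul_sub, smul_smul, smul_smul, inv_mul_cancel_left₀ alpha_ne_zero,
    inv_mul_cancel_left₀ alpha_ne_zero]

/-- Iterating `cross_qInt_step` moves `(a, b)` to `(a + b, 0)`, where the cross term vanishes. The
product with `k` squares moved receives `a + k` from the `k`-th step and `-(b - k)` from the next,
hence `a - b + 2k`; the initial product receives only `-b`. -/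
theorem cross_qOne {N a b : ℕ} (h : a + b ≤ N) :
    cross N (qOne a) (qOne b) = -((b : F) • (qOne a * qOne b)) +
      ∑ k ∈ Finset.Icc 1 b, ((a : F) - b + 2 * k) • (qOne (a + k) * qOne (b - k)) := by
  have key : ∀ b a : ℕ, a + b ≤ N → cross N (qOne a) (qOne b) + (b : F) • (qOne a * qOne b) =
      ∑ k ∈ Finset.range b, ((a : F) - b + 2 * (k + 1)) • (qOne (a + (k + 1)) * qOne (b - (k + 1))) := by
    intro b
    induction b with
    | zero =>
      intro a _
      simp [cross, qOne_zero]
    | succ b ih =>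
      intro a hab
      have hs := cross_qInt_step (N := N) (a := a) (b := b + 1) (by omega) (by omega)
      rw [add_sub_cancel_right] at hs
      have c1 : qInt ((a : ℤ) + 1) = qOne (a + 1) := by rw [← qInt_natCast]; norm_cast
      have c2 : qInt ((b : ℤ) + 1) = qOne (b + 1) := by rw [← qInt_natCast]; norm_cast
      rw [c1, c2, qInt_natCast, qInt_natCast] at hs
      rw [hs, Finset.sum_range_succ']
      have hi := ih (a + 1) (by omega)
      rw [← eq_sub_iff_add_eq] at hi
      rw [hi]
      have : ∀ k ∈ Finset.range b, (((a + 1 : ℕ) : F) - b + 2 * (k + 1)) •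
          (qOne (a + 1 + (k + 1)) * qOne (b - (k + 1))) =
          ((a : F) - (b + 1 : ℕ) + 2 * ((k + 1 : ℕ) + 1)) •
          (qOne (a + (k + 1 + 1)) * qOne (b + 1 - (k + 1 + 1))) := by
        intro k _
        rw [show a + 1 + (k + 1) = a + (k + 1 + 1) by ring, Nat.add_sub_add_right]
        refine congrArg (· • _) ?_
        push_cast
        ring
      rw [Finset.sum_congr rfl this]
      simp only [zero_add, Nat.cast_zero, Nat.add_sub_cancel, mul_one]
      push_cast
      rw [show (a : F) - (b + 1) + 2 = a + 1 - b by ring, sub_smul]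
      generalize ((a : F) + 1) • (qOne (a + 1) * qOne b) = x
      generalize (b : F) • (qOne (a + 1) * qOne b) = y
      generalize ((b : F) + 1) • (qOne a * qOne (b + 1)) = z
      abel
  rw [neg_add_eq_sub, eq_sub_iff_add_eq, key b a h]
  rw [← Finset.Ico_add_one_right_eq_Icc, Finset.sum_Ico_eq_sum_range, Nat.add_sub_cancel]
  refine Finset.sum_congr rfl fun k _ => ?_
  rw [add_comm 1 k]
  push_cast
  rfl

theorem cross_prod_left {ι : Type*} [DecidableEq ι] (N : ℕ) (s : Finset ι) (f : ι → Sym) (g : Sym) :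
    cross N (∏ i ∈ s, f i) g = ∑ i ∈ s, (∏ j ∈ s.erase i, f j) * cross N (f i) g := by
  unfold cross
  simp only [derivation_prod, mul_smul_comm]
  rw [← Finset.smul_sum]
  refine congrArg _ ?_
  simp only [Finset.mul_sum, Finset.sum_mul]
  rw [Finset.sum_comm (s := s)]
  refine Finset.sum_congr rfl fun x _ => ?_
  rw [Finset.sum_comm]
  exact Finset.sum_congr rfl fun i _ => Finset.sum_congr rfl fun y _ => by ring

/-- The composition `a` after `k` has been moved from its entry `j` to its entry `i`. -/
def moveFun (a : ℕ → ℕ) (i j k t : ℕ) : ℕ :=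
  if t = i then a i + k else if t = j then a j - k else a t

theorem movedRow_eq_moveFun {n : ℕ} (la : n.Partition) (i j k : ℕ) :
    movedRow la i j k = moveFun (row la) i j k := rfl

theorem prod_erase_mul_qOne (a : ℕ → ℕ) {i l : ℕ} (hi : i < l) (k : ℕ) :
    (∏ t ∈ (Finset.range l).erase i, qOne (a t)) * (qOne (a i + k) * qOne (a l - k)) =
      ∏ t ∈ Finset.range (l + 1), qOne (moveFun a i l k t) := by
  have h1 : moveFun a i l k l = a l - k := by simp [moveFun, hi.ne']
  have h2 : moveFun a i l k i = a i + k := by simp [moveFun]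
  rw [Finset.prod_range_succ, h1, ← Finset.prod_erase_mul _ _ (Finset.mem_range.2 hi), h2, mul_assoc]
  refine congrArg (· * _) (Finset.prod_congr rfl fun t ht => ?_)
  have h3 := Finset.ne_of_mem_erase ht
  have h4 := Finset.mem_range.1 (Finset.mem_of_mem_erase ht)
  rw [moveFun, if_neg h3, if_neg h4.ne]

/-- Each of the `l` earlier factors contributes `-a_l` to the diagonal, which is the source of the
term `∑ i λ_i` in the eigenvalue. -/
theorem cross_prod_qOne (a : ℕ → ℕ) {l N : ℕ} (h : ∑ t ∈ Finset.range (l + 1), a t ≤ N) :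
    cross N (∏ t ∈ Finset.range l, qOne (a t)) (qOne (a l)) =
      (-((l : F) * (a l : F))) • (∏ t ∈ Finset.range (l + 1), qOne (a t)) +
      ∑ i ∈ Finset.range l, ∑ k ∈ Finset.Icc 1 (a l), ((a i : F) - a l + 2 * k) •
        ∏ t ∈ Finset.range (l + 1), qOne (moveFun a i l k t) := by
  have h1 : ∀ i ∈ Finset.range l, (∏ t ∈ (Finset.range l).erase i, qOne (a t)) *
      cross N (qOne (a i)) (qOne (a l)) =
      (-(a l : F)) • (∏ t ∈ Finset.range (l + 1), qOne (a t)) +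
      ∑ k ∈ Finset.Icc 1 (a l), ((a i : F) - a l + 2 * k) •
        ∏ t ∈ Finset.range (l + 1), qOne (moveFun a i l k t) := by
    intro i hi
    have hal : a i + a l ≤ N := by
      rw [Finset.sum_range_succ] at h
      have := Finset.single_le_sum (f := a) (fun _ _ => Nat.zero_le _) hi
      omega
    rw [cross_qOne hal, mul_add, Finset.mul_sum, ← neg_smul, mul_smul_comm]
    refine congrArg₂ (· + ·) (congrArg _ ?_) (Finset.sum_congr rfl fun k _ => ?_)
    · rw [Finset.prod_range_succ, ← Finset.prod_erase_mul _ _ hi, mul_assoc]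
    · rw [mul_smul_comm, prod_erase_mul_qOne a (Finset.mem_range.1 hi)]
  rw [cross_prod_left, Finset.sum_congr rfl h1, Finset.sum_add_distrib, Finset.sum_const,
    Finset.card_range, ← Nat.cast_smul_eq_nsmul F, smul_smul, mul_neg]

/-- The Laplace–Beltrami operator on a product of one-row functions. -/
theorem lb_prod_qOne (a : ℕ → ℕ) {l N : ℕ} (h : ∑ t ∈ Finset.range l, a t ≤ N) :
    lb N (∏ t ∈ Finset.range l, qOne (a t)) =
      (∑ t ∈ Finset.range l, (α * (a t : F) * ((a t : F) - 1) / 2 - (t : F) * (a t : F))) •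
        (∏ t ∈ Finset.range l, qOne (a t)) +
      ∑ j ∈ Finset.range l, ∑ i ∈ Finset.range j, ∑ k ∈ Finset.Icc 1 (a j),
        ((a i : F) - a j + 2 * k) • ∏ t ∈ Finset.range l, qOne (moveFun a i j k t) := by
  induction l with
  | zero =>
    have := lb_qInt (N := N) (m := 0) (by omega)
    rw [show qInt 0 = 1 by rw [← qOne_zero, ← qInt_natCast]; rfl] at this
    simpa using this
  | succ l ih =>
    have h' := h
    rw [Finset.sum_range_succ] at h'
    have hl := lb_qInt (N := N) (m := a l) (by omega)
    rw [qInt_natCast, Int.cast_natCast] at hl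
    have hmove : ∀ j ∈ Finset.range l, ∀ i ∈ Finset.range j, ∀ k,
        (∏ t ∈ Finset.range l, qOne (moveFun a i j k t)) * qOne (a l) =
          ∏ t ∈ Finset.range (l + 1), qOne (moveFun a i j k t) := by
      intro j hj i hi k
      rw [Finset.mem_range] at hi hj
      rw [Finset.prod_range_succ, moveFun, if_neg (by omega), if_neg (by omega)]
    have hS : (∑ j ∈ Finset.range l, ∑ i ∈ Finset.range j, ∑ k ∈ Finset.Icc 1 (a j),
        ((a i : F) - a j + 2 * k) • ∏ t ∈ Finset.range l, qOne (moveFun a i j k t)) * qOne (a l) =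
        ∑ j ∈ Finset.range l, ∑ i ∈ Finset.range j, ∑ k ∈ Finset.Icc 1 (a j),
        ((a i : F) - a j + 2 * k) • ∏ t ∈ Finset.range (l + 1), qOne (moveFun a i j k t) := by
      simp only [Finset.sum_mul, smul_mul_assoc]
      exact Finset.sum_congr rfl fun j hj => Finset.sum_congr rfl fun i hi =>
        Finset.sum_congr rfl fun k _ => by rw [hmove j hj i hi k]
    conv_lhs => rw [Finset.prod_range_succ]
    rw [lb_mul, ih (by omega), hl, cross_prod_qOne a h, add_mul, hS, smul_mul_assoc, mul_smul_comm,
      ← Finset.prod_range_succ, Finset.sum_range_succ, Finset.sum_range_succ _ l, add_smul, sub_smul, neg_smul]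
    generalize (∏ t ∈ Finset.range (l + 1), qOne (a t)) = x
    generalize (∑ t ∈ Finset.range l, (α * (a t : F) * ((a t : F) - 1) / 2 - (t : F) * (a t : F))) • x = x₁
    generalize (α * (a l : F) * ((a l : F) - 1) / 2) • x = x₂
    generalize ((l : F) * (a l : F)) • x = x₃
    abel

variable {n : ℕ}

/-! ### Rows of partitions and the dominance order -/

theorem row_eq_zero_of_len_le (la : n.Partition) {i : ℕ} (h : len la ≤ i) : row la i = 0 := by
  by_contra h0
  exact absurd (lt_len_of_row_pos la (Nat.pos_of_ne_zero h0)) (not_lt.2 h)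

theorem row_pos_of_lt_len (la : n.Partition) {i : ℕ} (h : i < len la) : 0 < row la i := by
  apply la.parts_pos
  rw [parts_eq_map_row]
  exact Multiset.mem_map_of_mem _ (Multiset.mem_range.2 h)

theorem sum_map_parts {M : Type*} [AddCommMonoid M] (la : n.Partition) (g : ℕ → M) :
    (la.parts.map g).sum = ∑ i ∈ Finset.range (len la), g (row la i) := by
  conv_lhs => rw [parts_eq_map_row, Multiset.map_map]
  rfl

theorem sum_range_len_row (la : n.Partition) : ∑ i ∈ Finset.range (len la), row la i = n := by
  rw [← sum_map_parts la fun x => x, Multiset.map_id', la.parts_sum]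

theorem eq_of_row_eq {la mu : n.Partition} (h : row la = row mu) : la = mu := by
  have hl : len la = len mu := by
    apply le_antisymm <;> by_contra! hlt
    · have := row_pos_of_lt_len la hlt
      rw [h, row_eq_zero_of_len_le mu le_rfl] at this
      exact lt_irrefl _ this
    · have := row_pos_of_lt_len mu hlt
      rw [← h, row_eq_zero_of_len_le la le_rfl] at this
      exact lt_irrefl _ this
  apply Nat.Partition.ext
  rw [parts_eq_map_row, parts_eq_map_row mu, h, hl]

theorem Dom.refl (la : n.Partition) : Dom la la := fun _ => le_rfl

theorem Dom.trans {la mu nu : n.Partition} (h : Dom la mu) (h' : Dom mu nu) : Dom la nu :=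
  fun i => (h i).trans (h' i)

theorem Dom.antisymm {la mu : n.Partition} (h : Dom la mu) (h' : Dom mu la) : la = mu := by
  have e : ∀ i, ∑ j ∈ Finset.range i, row la j = ∑ j ∈ Finset.range i, row mu j :=
    fun i => le_antisymm (h i) (h' i)
  apply eq_of_row_eq
  funext i
  have := e (i + 1)
  rw [Finset.sum_range_succ, Finset.sum_range_succ, e i] at this
  exact Nat.add_left_cancel this

theorem mem_above {la mu : n.Partition} : mu ∈ above la ↔ Dom la mu := by simp [above]

theorem mem_below {la mu : n.Partition} : mu ∈ below la ↔ Dom mu la := by simp [below, mem_above]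

/-- `∑_i i λ_i`. -/
def rowStat (la : n.Partition) : ℕ := ∑ i ∈ Finset.range (len la), (i + 1) * row la i

/-- Abel summation: larger partial sums mean a smaller `∑ i λ_i`. -/
theorem sum_partial_sums_add_rowStat (la : n.Partition) {M : ℕ} (hM : len la ≤ M) :
    ∑ m ∈ Finset.range M, ∑ j ∈ Finset.range m, row la j + rowStat la = M * n := by
  have h1 : ∀ K, ∑ m ∈ Finset.range K, ∑ j ∈ Finset.range m, row la j +
      ∑ t ∈ Finset.range K, (t + 1) * row la t = K * ∑ t ∈ Finset.range K, row la t := by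
    intro K
    induction K with
    | zero => simp
    | succ K ih =>
      rw [Finset.sum_range_succ, Finset.sum_range_succ _ K, Finset.sum_range_succ _ K]
      linarith
  have hsub : Finset.range (len la) ⊆ Finset.range M := Finset.range_mono hM
  have h2 : rowStat la = ∑ t ∈ Finset.range M, (t + 1) * row la t := by
    refine Finset.sum_subset hsub fun t _ ht => ?_
    rw [row_eq_zero_of_len_le la (by simpa using ht), mul_zero]
  have h3 : ∑ t ∈ Finset.range M, row la t = n := by
    refine Eq.trans (Finset.sum_subset hsub fun t _ ht => ?_).symm (sum_range_len_row la)
    exact row_eq_zero_of_len_le la (by simpa using ht)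
  rw [h2, h1, h3]

theorem rowStat_lt {la mu : n.Partition} (h : Dom la mu) (hne : mu ≠ la) :
    rowStat mu < rowStat la := by
  -- The extra `1` makes both partial sums around each possibly non-zero row available, so that
  -- equal partial sums force equal rows.
  set M := len la + len mu + 1 with hM
  have h1 := sum_partial_sums_add_rowStat la (M := M) (by omega)
  have h2 := sum_partial_sums_add_rowStat mu (M := M) (by omega)
  have hlt : ∑ m ∈ Finset.range M, ∑ j ∈ Finset.range m, row la j <
      ∑ m ∈ Finset.range M, ∑ j ∈ Finset.range m, row mu j := by
    refine lt_of_le_of_ne (Finset.sum_le_sum fun m _ => h m) fun heq => hne ?_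
    rw [Finset.sum_eq_sum_iff_of_le fun m _ => h m] at heq
    apply eq_of_row_eq
    funext i
    by_cases hi : i < len la + len mu
    · have e1 := heq i (Finset.mem_range.2 (by omega))
      have e2 := heq (i + 1) (Finset.mem_range.2 (by omega))
      rw [Finset.sum_range_succ, Finset.sum_range_succ, e1] at e2
      exact (Nat.add_left_cancel e2).symm
    · rw [row_eq_zero_of_len_le la (by omega), row_eq_zero_of_len_le mu (by omega)]
  omega

/-- The expression is a polynomial in `α` whose value at `α = 0` is `-2(u - v)`. -/
theorem alpha_mul_sub_ne_zero (s t u v : ℕ) (h : u ≠ v) :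
    α * ((s : F) - t) - 2 * ((u : F) - v) ≠ 0 := by
  intro h0
  have h1 : algebraMap (Polynomial ℚ) F
      (Polynomial.X * ((s : Polynomial ℚ) - (t : Polynomial ℚ)) -
        2 * ((u : Polynomial ℚ) - (v : Polynomial ℚ))) = 0 := by
    rw [← h0]
    simp only [map_sub, map_mul, map_natCast, map_ofNat, RatFunc.algebraMap_X]
  have h2 := (map_eq_zero_iff _ (RatFunc.algebraMap_injective ℚ)).1 h1
  have h3 := congrArg (Polynomial.eval 0) h2
  simp at h3
  have h4 : (u : ℚ) = v := sub_eq_zero.1 h3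
  exact h (by exact_mod_cast h4)

theorem e'_sub_e'_ne_zero {la mu : n.Partition} (h : Dom la mu) (hne : mu ≠ la) :
    e' la - e' mu ≠ 0 := by
  have he : ∀ nu : n.Partition, e' nu = 1 / 2 * α *
      ((∑ i ∈ Finset.range (len nu), row nu i ^ 2 : ℕ) : F) - (rowStat nu : F) := by
    intro nu
    rw [e', rowStat]
    push_cast
    rfl
  intro h0
  refine alpha_mul_sub_ne_zero (∑ i ∈ Finset.range (len la), row la i ^ 2)
    (∑ i ∈ Finset.range (len mu), row mu i ^ 2) _ _ (rowStat_lt h hne).ne' ?_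
  rw [he, he] at h0
  linear_combination 2 * h0

/-! ### Rearrangements -/

/-- The partial sums of a composition are at most those of its decreasing rearrangement. -/
theorem sum_range_le_sum_row {mu : n.Partition} {f : ℕ → ℕ} {l : ℕ}
    (h : mu.parts = ((Multiset.range l).map f).filter (· ≠ 0)) (hf : ∀ t, l ≤ t → f t = 0) (m : ℕ) :
    ∑ t ∈ Finset.range m, f t ≤ ∑ t ∈ Finset.range m, row mu t := by
  -- The threshold `c` separates the first `m` rows from the rest. The total truncated excess over
  -- `c` is invariant under rearrangement, bounds the first `m` entries of `f`, and for `mu` is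
  -- carried by its first `m` rows.
  set c := row mu m with hc
  have h1 : ∑ t ∈ Finset.range l, (f t - c) = ∑ t ∈ Finset.range (len mu), (row mu t - c) := by
    rw [← sum_map_parts mu fun x => x - c, h]
    have : ∀ s : Multiset ℕ, ((s.filter (· ≠ 0)).map fun x => x - c).sum =
        (s.map fun x => x - c).sum := by
      intro s
      induction s using Multiset.induction_on with
      | empty => rfl
      | cons a s ih =>
        by_cases ha : a ≠ 0
        · rw [Multiset.filter_cons_of_pos (p := (· ≠ 0)) _ ha, Multiset.map_cons, Multiset.sum_cons, ih,
            Multiset.map_cons, Multiset.sum_cons]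
        · rw [Multiset.filter_cons_of_neg (p := (· ≠ 0)) _ ha, ih, Multiset.map_cons, Multiset.sum_cons]
          omega
    rw [this, Multiset.map_map]
    rfl
  calc ∑ t ∈ Finset.range m, f t ≤ ∑ t ∈ Finset.range m, (c + (f t - c)) :=
        Finset.sum_le_sum fun t _ => by omega
    _ = ∑ t ∈ Finset.range m, c + ∑ t ∈ Finset.range m, (f t - c) := Finset.sum_add_distrib
    _ ≤ ∑ t ∈ Finset.range m, c + ∑ t ∈ Finset.range l, (f t - c) := by
        refine Nat.add_le_add_left (Finset.sum_le_sum_of_ne_zero fun t _ ht => ?_) _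
        rw [Finset.mem_range]
        by_contra! hlt
        exact ht (by rw [hf t hlt, Nat.zero_sub])
    _ = ∑ t ∈ Finset.range m, c + ∑ t ∈ Finset.range (len mu), (row mu t - c) := by rw [h1]
    _ ≤ ∑ t ∈ Finset.range m, c + ∑ t ∈ Finset.range m, (row mu t - c) := by
        refine Nat.add_le_add_left (Finset.sum_le_sum_of_ne_zero fun t _ ht => ?_) _
        rw [Finset.mem_range]
        by_contra! hlt
        have := row_anti mu hlt
        omega
    _ = ∑ t ∈ Finset.range m, (c + (row mu t - c)) := Finset.sum_add_distrib.symm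
    _ = ∑ t ∈ Finset.range m, row mu t := by
        refine Finset.sum_congr rfl fun t ht => ?_
        have := row_anti mu (Finset.mem_range.1 ht).le
        omega

theorem sum_range_moveFun (a : ℕ → ℕ) {i j k : ℕ} (hij : i < j) (hk : k ≤ a j) (m : ℕ) :
    ∑ t ∈ Finset.range m, moveFun a i j k t + (if j < m then k else 0) =
      ∑ t ∈ Finset.range m, a t + if i < m then k else 0 := by
  have h1 : ∀ t, moveFun a i j k t + (if t = j then k else 0) = a t + if t = i then k else 0 := by
    intro t
    unfold moveFun
    split_ifs <;> subst_vars <;> omega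
  have h2 := Finset.sum_congr (rfl : Finset.range m = Finset.range m) fun t _ => h1 t
  rw [Finset.sum_add_distrib, Finset.sum_add_distrib, Finset.sum_ite_eq', Finset.sum_ite_eq'] at h2
  simpa only [Finset.mem_range] using h2

theorem IsMoveUp.dom {la mu : n.Partition} {i j k : ℕ} (h : IsMoveUp la mu i j k) : Dom la mu := by
  intro m
  obtain ⟨hij, hk, hkj, hmu⟩ := h
  have hj := lt_len_of_row_pos la (lt_of_lt_of_le hk hkj)
  refine le_trans ?_ (sum_range_le_sum_row hmu (fun t ht => ?_) m)
  · have := sum_range_moveFun (row la) hij hkj m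
    rw [movedRow_eq_moveFun]
    split_ifs at this <;> omega
  · rw [movedRow, if_neg (by omega), if_neg (by omega), row_eq_zero_of_len_le la ht]

theorem IsMoveUp.ne {la mu : n.Partition} {i j k : ℕ} (h : IsMoveUp la mu i j k) : mu ≠ la := by
  rintro rfl
  have h1 := isMoveUp_parts h
  rw [add_assoc] at h1
  have h2 := add_left_cancel h1
  have h3 : row mu i + k ∈ ({row mu i, row mu j} : Multiset ℕ) := by
    rw [h2]
    simp
  have h4 := row_anti mu h.1.le
  have h5 := h.2.1
  simp only [Multiset.insert_eq_cons, Multiset.mem_cons, Multiset.mem_singleton] at h3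
  omega

/-! ### The Laplace–Beltrami operator on the `q_λ` -/

theorem q_eq_prod_row (la : n.Partition) : q la = ∏ t ∈ Finset.range (len la), qOne (row la t) := by
  rw [q]
  conv_lhs => rw [parts_eq_map_row, Multiset.map_map]
  rfl

theorem q_eq_prod {mu : n.Partition} {f : ℕ → ℕ} {l : ℕ}
    (h : mu.parts = ((Multiset.range l).map f).filter (· ≠ 0)) :
    q mu = ∏ t ∈ Finset.range l, qOne (f t) := by
  rw [q, h]
  have : ∀ s : Multiset ℕ, ((s.filter (· ≠ 0)).map qOne).prod = (s.map qOne).prod := by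
    intro s
    induction s using Multiset.induction_on with
    | empty => rfl
    | cons a s ih =>
      by_cases ha : a ≠ 0
      · rw [Multiset.filter_cons_of_pos (p := (· ≠ 0)) _ ha, Multiset.map_cons, Multiset.prod_cons, ih,
          Multiset.map_cons, Multiset.prod_cons]
      · rw [Multiset.filter_cons_of_neg (p := (· ≠ 0)) _ ha, ih, Multiset.map_cons, Multiset.prod_cons,
          not_not.1 ha, qOne_zero, one_mul]
  rw [this, Multiset.map_map]
  rfl

theorem exists_isMoveUp (la : n.Partition) {i j k : ℕ} (hij : i < j) (hj : j < len la) (hk : 0 < k)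
    (hkj : k ≤ row la j) : ∃ mu : n.Partition, IsMoveUp la mu i j k := by
  have hs : ((Multiset.range (len la)).map (movedRow la i j k)).sum = n := by
    have := sum_range_moveFun (row la) hij hkj (len la)
    rw [if_pos hj, if_pos (hij.trans hj), sum_range_len_row] at this
    exact Nat.add_right_cancel this
  exact ⟨Nat.Partition.ofSums n _ hs, hij, hk, hkj, rfl⟩

/-- The result of a move depends only on the two row lengths and on `k`, and determines them.
Counting operators from `la` to `mu` thus becomes counting pairs of rows. -/
theorem isMoveUp_iff {la mu : n.Partition} {i j k i' j' k' : ℕ} (h : IsMoveUp la mu i j k) :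
    IsMoveUp la mu i' j' k' ↔ i' < j' ∧ row la i' = row la i ∧ row la j' = row la j ∧ k' = k := by
  constructor
  · intro h'
    obtain ⟨h1, h2, h3⟩ := isMoveUp_unique h' h
    exact ⟨h'.1, h1, h2, h3⟩
  · rintro ⟨h1, h2, h3, rfl⟩
    have hkj : k' ≤ row la j' := h3 ▸ h.2.2.1
    obtain ⟨nu, hnu⟩ := exists_isMoveUp la h1
      (lt_len_of_row_pos la (lt_of_lt_of_le h.2.1 hkj)) h.2.1 hkj
    have e1 := isMoveUp_parts h
    have e2 := isMoveUp_parts hnu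
    rw [h2, h3, ← e1] at e2
    rwa [← Nat.Partition.ext (add_right_cancel e2)]

/-! ### Counting the moving up operators with a given result -/

theorem mult_eq_sum (la : n.Partition) (a : ℕ) :
    (mult la a : F) = ∑ i ∈ Finset.range (len la), if row la i = a then 1 else 0 := by
  rw [mult, Multiset.count_eq_card_filter_eq, ← Multiset.countP_eq_card_filter, parts_eq_map_row,
    Multiset.countP_map, ← Finset.sum_filter, Finset.sum_const, nsmul_one]
  congr 1
  simp only [eq_comm (a := a)]
  rfl

theorem sum_range_sum_range_mul {K : Type*} [Field K] [CharZero K] (x : ℕ → K)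
    (hx : ∀ i, x i * x i = x i) (l : ℕ) :
    ∑ j ∈ Finset.range l, ∑ i ∈ Finset.range j, x i * x j =
      2⁻¹ * (∑ i ∈ Finset.range l, x i) * (∑ i ∈ Finset.range l, x i - 1) := by
  induction l with
  | zero => simp
  | succ l ih =>
    rw [Finset.sum_range_succ, ih, ← Finset.sum_mul, Finset.sum_range_succ]
    have := hx l
    field_simp
    linear_combination -this

/-- The number of pairs of rows of given lengths. -/
theorem sum_pairs_eq (la : n.Partition) {a b : ℕ} (hab : b ≤ a) :
    (∑ j ∈ Finset.range (len la), ∑ i ∈ Finset.range j,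
      if row la i = a ∧ row la j = b then (1 : F) else 0) =
    (1 + if a = b then 1 else 0)⁻¹ * (mult la a : F) *
      ((mult la b : F) - if a = b then 1 else 0) := by
  have hprod : ∀ i j, (if row la i = a ∧ row la j = b then (1 : F) else 0) =
      (if row la i = a then 1 else 0) * (if row la j = b then 1 else 0) := by
    intro i j
    split_ifs <;> simp_all
  simp only [hprod, mult_eq_sum]
  -- Equal lengths give a binomial coefficient. For `b < a` every row of length `a` precedes every
  -- row of length `b`, so the condition `i < j` can be dropped.
  by_cases h : a = b
  · subst h
    rw [if_pos rfl, one_add_one_eq_two]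
    exact sum_range_sum_range_mul (fun i => if row la i = a then (1 : F) else 0)
      (fun i => by split_ifs <;> simp) _
  · rw [if_neg h, add_zero, inv_one, one_mul, sub_zero, Finset.sum_mul_sum,
      Finset.sum_comm (s := Finset.range (len la)) (t := Finset.range (len la))]
    refine Finset.sum_congr rfl fun j hj => ?_
    refine Finset.sum_subset (Finset.range_mono (Finset.mem_range.1 hj).le) fun i _ hi => ?_
    rw [← hprod, if_neg]
    rintro ⟨rfl, rfl⟩
    rw [Finset.mem_range, not_lt] at hi
    exact h (le_antisymm (row_anti la hi) hab)

open Classical in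
theorem sum_isMoveUp_eq (la mu : n.Partition) :
    (∑ j ∈ Finset.range (len la), ∑ i ∈ Finset.range j, ∑ k ∈ Finset.Icc 1 (row la j),
      if IsMoveUp la mu i j k then (row la i : F) - row la j + 2 * k else 0) =
    if mu ∈ movingUp la then r la mu else 0 := by
  split_ifs with h
  · obtain ⟨i₀, j₀, k₀, h⟩ := h
    have h1 : ∀ j, ∀ i ∈ Finset.range j, (∑ k ∈ Finset.Icc 1 (row la j),
        if IsMoveUp la mu i j k then (row la i : F) - row la j + 2 * k else 0) =
        (if row la i = row la i₀ ∧ row la j = row la j₀ then 1 else 0) *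
          ((row la i₀ : F) - row la j₀ + 2 * k₀) := by
      intro j i hi
      simp only [isMoveUp_iff h]
      by_cases hc : row la i = row la i₀ ∧ row la j = row la j₀
      · have hk : k₀ ∈ Finset.Icc 1 (row la j) :=
          Finset.mem_Icc.2 ⟨h.2.1, hc.2 ▸ h.2.2.1⟩
        rw [if_pos hc, one_mul, Finset.sum_eq_single_of_mem k₀ hk]
        · rw [if_pos ⟨Finset.mem_range.1 hi, hc.1, hc.2, rfl⟩, hc.1, hc.2]
        · intro k _ hk
          rw [if_neg fun hh => hk hh.2.2.2]
      · rw [if_neg hc, zero_mul]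
        exact Finset.sum_eq_zero fun k _ => if_neg fun hh => hc ⟨hh.2.1, hh.2.2.1⟩
    rw [Finset.sum_congr rfl fun j _ => Finset.sum_congr rfl (h1 j)]
    simp only [← Finset.sum_mul]
    rw [sum_pairs_eq la (row_anti la h.1.le), r_eq_of_isMoveUp h, moveCoeff]
  · exact Finset.sum_eq_zero fun j _ => Finset.sum_eq_zero fun i _ => Finset.sum_eq_zero fun k _ =>
      if_neg fun hh => h ⟨i, j, k, hh⟩

/-- The eigenvalue of the Laplace–Beltrami operator on the Jack function of `λ`. -/
noncomputable def lbEigenvalue (la : n.Partition) : F := e' la - α * n / 2 + n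

open Classical in
/-- The Laplace–Beltrami operator is triangular on the `q_λ`, with off-diagonal entries `r_{λμ}`. -/
theorem lb_q (la : n.Partition) : lb n (q la) = lbEigenvalue la • q la +
    ∑ mu : n.Partition, (if mu ∈ movingUp la then r la mu else 0) • q mu := by
  rw [q_eq_prod_row, lb_prod_qOne _ (sum_range_len_row la).le]
  refine congrArg₂ (· + ·) (congrArg (· • _) ?_) ?_
  · have hn : (n : F) = ∑ i ∈ Finset.range (len la), (row la i : F) := by
      conv_lhs => rw [← sum_range_len_row la]
      push_cast
      rfl
    rw [lbEigenvalue, e', hn, Finset.mul_sum, Finset.mul_sum, Finset.sum_div,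
      ← Finset.sum_sub_distrib, ← Finset.sum_sub_distrib, ← Finset.sum_add_distrib]
    refine Finset.sum_congr rfl fun i _ => ?_
    push_cast
    ring
  · have hq : ∀ j ∈ Finset.range (len la), ∀ i ∈ Finset.range j, ∀ k ∈ Finset.Icc 1 (row la j),
        ((row la i : F) - row la j + 2 * k) •
          ∏ t ∈ Finset.range (len la), qOne (moveFun (row la) i j k t) =
        ∑ mu : n.Partition,
          (if IsMoveUp la mu i j k then (row la i : F) - row la j + 2 * k else 0) • q mu := by
      intro j hj i hi k hk
      rw [Finset.mem_range] at hi hj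
      rw [Finset.mem_Icc] at hk
      obtain ⟨mu, hmu⟩ := exists_isMoveUp la hi hj hk.1 hk.2
      rw [Finset.sum_eq_single_of_mem mu (Finset.mem_univ _), if_pos hmu, q_eq_prod hmu.2.2.2,
        movedRow_eq_moveFun]
      intro nu _ hne
      rw [if_neg, zero_smul]
      exact fun hnu => hne (Nat.Partition.ext (hnu.2.2.2.trans hmu.2.2.2.symm))
    rw [Finset.sum_congr rfl fun j hj => Finset.sum_congr rfl fun i hi =>
      Finset.sum_congr rfl (hq j hj i hi)]
    simp only [← sum_isMoveUp_eq, Finset.sum_smul]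
    symm
    rw [Finset.sum_comm]
    refine Finset.sum_congr rfl fun j _ => ?_
    rw [Finset.sum_comm]
    refine Finset.sum_congr rfl fun i _ => ?_
    rw [Finset.sum_comm]

/-! ### The `q_λ` and a Jack family -/

/-- The exponent vector of the monomial `x^λ`. -/
noncomputable def rowExp (la : n.Partition) : ℕ →₀ ℕ :=
  Finsupp.onFinset (Finset.range (len la)) (row la) fun _ h =>
    Finset.mem_range.2 (lt_len_of_row_pos la (Nat.pos_of_ne_zero h))

theorem rowExp_support (la : n.Partition) : (rowExp la).support = Finset.range (len la) := by
  ext i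
  rw [Finsupp.mem_support_iff, Finset.mem_range]
  exact ⟨fun h => lt_len_of_row_pos la (Nat.pos_of_ne_zero h),
    fun h => (row_pos_of_lt_len la h).ne'⟩

theorem qExp_rowExp (la : n.Partition) : qExp (rowExp la) = q la := by
  rw [q_eq_prod_row, qExp_eq_prod (rowExp_support la).subset]
  rfl

theorem map_rowExp (la : n.Partition) :
    (rowExp la).support.val.map (fun i => rowExp la i) = la.parts := by
  rw [rowExp_support, parts_eq_map_row la]
  rfl

theorem coeff_monomialSymm (la : n.Partition) (d : ℕ →₀ ℕ) :
    MvPowerSeries.coeff d (monomialSymm la) =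
      if d.support.val.map (fun i => d i) = la.parts then (1 : F) else 0 := by
  classical
  change monomialSymm la d = _
  unfold monomialSymm
  congr

theorem qExp_isWeightedHomogeneous (d : ℕ →₀ ℕ) :
    IsWeightedHomogeneous (fun k : ℕ+ => (k : ℕ)) (qExp d) (∑ i ∈ d.support, d i) :=
  IsWeightedHomogeneous.prod _ _ _ fun i _ => qOne_isWeightedHomogeneous (d i)

theorem sum_rowExp (la : n.Partition) : ∑ i ∈ (rowExp la).support, rowExp la i = n := by
  rw [rowExp_support]
  exact sum_range_len_row la

theorem jackForm_q_qExp (la : n.Partition) {d : ℕ →₀ ℕ} (hd : ∑ i ∈ d.support, d i ≠ n) :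
    jackForm (q la) (qExp d) = 0 := by
  rw [← qExp_rowExp]
  refine jackForm_eq_zero_of_isWeightedHomogeneous (qExp_isWeightedHomogeneous _)
    (qExp_isWeightedHomogeneous _) ?_
  rw [sum_rowExp]
  exact hd.symm

theorem exists_parts_eq {d : ℕ →₀ ℕ} (hd : ∑ i ∈ d.support, d i = n) :
    ∃ la : n.Partition, qExp d = q la := by
  have hs : (d.support.val.map fun i => d i).sum = n := hd
  refine ⟨⟨d.support.val.map fun i => d i, fun hi => ?_, hs⟩, ?_⟩
  · obtain ⟨j, hj, rfl⟩ := Multiset.mem_map.1 hi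
    exact Nat.pos_of_ne_zero (Finsupp.mem_support_iff.1 hj)
  · rw [q, Multiset.map_map]
    rfl

variable {P : n.Partition → Sym}

theorem IsJackFamily.jackForm_qExp (hP : IsJackFamily n P) (la : n.Partition) {d : ℕ →₀ ℕ}
    (hd : ∑ i ∈ d.support, d i ≠ n) : jackForm (P la) (qExp d) = 0 := by
  obtain ⟨c, -, hc⟩ := hP.1 la
  rw [← coeff_realize, hc, map_sum]
  refine Finset.sum_eq_zero fun mu _ => ?_
  rw [map_smul, coeff_monomialSymm, if_neg, smul_zero]
  intro h
  refine hd ?_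
  rw [← mu.parts_sum, ← h]
  rfl

/-- Pairing with `q_μ` extracts the coefficient of `x^μ`, so the monomial expansion of `P_λ` becomes
a table of scalar products. -/
theorem IsJackFamily.exists_jackForm_q (hP : IsJackFamily n P) (la : n.Partition) :
    ∃ c : n.Partition → F, c la = 1 ∧
      ∀ mu, jackForm (P la) (q mu) = if mu ∈ below la then c mu else 0 := by
  classical
  obtain ⟨c, hc1, hc⟩ := hP.1 la
  refine ⟨c, hc1, fun mu => ?_⟩
  rw [← qExp_rowExp, ← coeff_realize, hc, map_sum]
  simp only [map_smul, coeff_monomialSymm, map_rowExp, smul_eq_mul, mul_ite, mul_one, mul_zero]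
  rw [← Finset.sum_ite_eq (below la) mu c]
  refine Finset.sum_congr rfl fun nu _ => ?_
  simp only [Nat.Partition.ext_iff]

theorem IsJackFamily.jackForm_q_self (hP : IsJackFamily n P) (la : n.Partition) :
    jackForm (P la) (q la) = 1 := by
  obtain ⟨c, hc1, hc⟩ := hP.exists_jackForm_q la
  rw [hc, if_pos (mem_below.2 (Dom.refl la)), hc1]

theorem IsJackFamily.jackForm_q_of_not_dom (hP : IsJackFamily n P) {la mu : n.Partition}
    (h : ¬ Dom mu la) : jackForm (P la) (q mu) = 0 := by
  obtain ⟨c, -, hc⟩ := hP.exists_jackForm_q la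
  rw [hc, if_neg fun h' => h (mem_below.1 h')]

/-- Strict dominance is well-founded. -/
theorem wellFounded_dom : WellFounded fun la mu : n.Partition => Dom la mu ∧ la ≠ mu := by
  have : IsTrans n.Partition fun la mu => Dom la mu ∧ la ≠ mu :=
    ⟨fun a b c h h' => ⟨h.1.trans h'.1, fun e => h.2 (h.1.antisymm (e ▸ h'.1))⟩⟩
  have : Std.Irrefl fun la mu : n.Partition => Dom la mu ∧ la ≠ mu := ⟨fun _ h => h.2 rfl⟩
  exact Finite.wellFounded_of_trans_of_irrefl _

/-- The reverse of strict dominance is well-founded. -/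
theorem wellFounded_dom_swap : WellFounded fun la mu : n.Partition => Dom mu la ∧ mu ≠ la := by
  have : IsTrans n.Partition fun la mu => Dom mu la ∧ mu ≠ la :=
    ⟨fun a b c h h' => ⟨h'.1.trans h.1, fun e => h.2 (h.1.antisymm (e ▸ h'.1))⟩⟩
  have : Std.Irrefl fun la mu : n.Partition => Dom mu la ∧ mu ≠ la := ⟨fun _ h => h.2 rfl⟩
  exact Finite.wellFounded_of_trans_of_irrefl _

/-- The span of a Jack family contains the basis dual to the `q_λ`. -/
theorem IsJackFamily.exists_dual (hP : IsJackFamily n P) (la : n.Partition) :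
    ∃ g ∈ Submodule.span F (Set.range P), jackForm g (q la) = 1 ∧
      ∀ mu, mu ≠ la → jackForm g (q mu) = 0 := by
  classical
  induction la using wellFounded_dom.induction with
  | _ la ih =>
    choose! g hg h1 h0 using ih
    -- Inversion of a unitriangular matrix: the unwanted pairings of `P_λ` with `q_μ`, `μ < λ`, are
    -- removed by the dual elements already constructed.
    set s := (below la).erase la with hs
    have hmem : ∀ mu, mu ∈ s ↔ Dom mu la ∧ mu ≠ la := fun mu => by
      rw [hs, Finset.mem_erase, mem_below, and_comm]
    have key : ∀ nu, jackForm (P la - ∑ mu ∈ s, jackForm (P la) (q mu) • g mu) (q nu) =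
        jackForm (P la) (q nu) - if nu ∈ s then jackForm (P la) (q nu) else 0 := by
      intro nu
      simp only [map_sub, map_sum, map_smul, LinearMap.sub_apply, LinearMap.sum_apply,
        LinearMap.smul_apply, smul_eq_mul]
      congr 1
      rw [← Finset.sum_ite_eq s nu fun mu => jackForm (P la) (q mu)]
      refine Finset.sum_congr rfl fun mu hmu => ?_
      have hmu' := (hmem mu).1 hmu
      split_ifs with e
      · rw [e, h1 mu hmu', mul_one]
      · rw [h0 mu hmu' nu e, mul_zero]
    refine ⟨P la - ∑ mu ∈ s, jackForm (P la) (q mu) • g mu, ?_, ?_, fun nu hnu => ?_⟩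
    · exact Submodule.sub_mem _ (Submodule.subset_span ⟨la, rfl⟩) (Submodule.sum_mem _ fun mu hmu =>
        Submodule.smul_mem _ _ (hg mu ((hmem mu).1 hmu)))
    · rw [key, if_neg fun h => ((hmem la).1 h).2 rfl, sub_zero, hP.jackForm_q_self]
    · rw [key]
      split_ifs with h
      · rw [sub_self]
      · rw [sub_zero, hP.jackForm_q_of_not_dom fun h' => h ((hmem nu).2 ⟨h', hnu⟩)]

theorem IsJackFamily.jackForm_span_qExp (hP : IsJackFamily n P) {f : Sym}
    (hf : f ∈ Submodule.span F (Set.range P)) {d : ℕ →₀ ℕ} (hd : ∑ i ∈ d.support, d i ≠ n) :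
    jackForm f (qExp d) = 0 := by
  induction hf using Submodule.span_induction with
  | mem x hx => obtain ⟨la, rfl⟩ := hx; exact hP.jackForm_qExp la hd
  | zero => rw [map_zero, LinearMap.zero_apply]
  | add x y _ _ hx hy => rw [map_add, LinearMap.add_apply, hx, hy, add_zero]
  | smul c x _ hx => rw [map_smul, LinearMap.smul_apply, hx, smul_zero]

/-- Subtracting the expected combination of dual elements leaves something orthogonal to all
products of one-row functions: in degree `n` by duality, in other degrees by homogeneity. These
products span and the form is non-degenerate. -/
theorem IsJackFamily.q_mem_span (hP : IsJackFamily n P) (la : n.Partition) :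
    q la ∈ Submodule.span F (Set.range P) := by
  choose g hg h1 h0 using hP.exists_dual
  have hmem : ∑ mu : n.Partition, jackForm (q la) (q mu) • g mu ∈
      Submodule.span F (Set.range P) :=
    Submodule.sum_mem _ fun mu _ => Submodule.smul_mem _ _ (hg mu)
  have : q la - ∑ mu : n.Partition, jackForm (q la) (q mu) • g mu = 0 := by
    refine eq_zero_of_jackForm_qExp_eq_zero fun d => ?_
    rw [map_sub, LinearMap.sub_apply]
    by_cases hd : ∑ i ∈ d.support, d i = n
    · obtain ⟨nu, hnu⟩ := exists_parts_eq hd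
      rw [hnu, map_sum, LinearMap.sum_apply, Finset.sum_eq_single_of_mem nu (Finset.mem_univ _),
        map_smul, LinearMap.smul_apply, h1, smul_eq_mul, mul_one, sub_self]
      intro mu _ hmu
      rw [map_smul, LinearMap.smul_apply, h0 mu nu hmu.symm, smul_zero]
    · rw [jackForm_q_qExp la hd, hP.jackForm_span_qExp hmem hd, sub_zero]
  rw [sub_eq_zero.1 this]
  exact hmem

theorem IsJackFamily.jackForm_of_ne (hP : IsJackFamily n P) {la mu : n.Partition} (h : la ≠ mu) :
    jackForm (P la) (P mu) = 0 := hP.2 la mu h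

/-- An isotropic `P_λ` would be orthogonal to the whole span of the family, which contains `q_λ`,
yet `⟨P_λ, q_λ⟩ = 1`. -/
theorem IsJackFamily.jackForm_self_ne_zero (hP : IsJackFamily n P) (la : n.Partition) :
    jackForm (P la) (P la) ≠ 0 := by
  intro h
  have h0 : ∀ f ∈ Submodule.span F (Set.range P), jackForm (P la) f = 0 := by
    intro f hf
    have : Submodule.span F (Set.range P) ≤ LinearMap.ker (jackForm (P la)) := by
      rw [Submodule.span_le]
      rintro _ ⟨mu, rfl⟩
      by_cases e : la = mu
      · exact e ▸ h
      · exact hP.jackForm_of_ne e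
    exact this hf
  have := hP.jackForm_q_self la
  rw [h0 _ (hP.q_mem_span la)] at this
  exact zero_ne_one this

theorem IsJackFamily.jackForm_dualJack_self (hP : IsJackFamily n P) (la : n.Partition) :
    jackForm (dualJack P la) (P la) = 1 := by
  rw [dualJack, map_smul, LinearMap.smul_apply, ← jackForm_apply, smul_eq_mul,
    inv_mul_cancel₀ (hP.jackForm_self_ne_zero la)]

theorem IsJackFamily.smul_dualJack (hP : IsJackFamily n P) (la : n.Partition) :
    jackForm (P la) (P la) • dualJack P la = P la := by
  rw [dualJack, ← jackForm_apply, smul_smul, mul_inv_cancel₀ (hP.jackForm_self_ne_zero la), one_smul]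

/-- The expansion of an element of the span of a Jack family in the dual Jack functions. -/
theorem IsJackFamily.eq_sum_dualJack (hP : IsJackFamily n P) {f : Sym}
    (hf : f ∈ Submodule.span F (Set.range P)) :
    f = ∑ ka : n.Partition, jackForm f (P ka) • dualJack P ka := by
  induction hf using Submodule.span_induction with
  | mem x hx =>
    obtain ⟨la, rfl⟩ := hx
    rw [Finset.sum_eq_single_of_mem la (Finset.mem_univ _), hP.smul_dualJack]
    intro mu _ hmu
    rw [hP.jackForm_of_ne hmu.symm, zero_smul]
  | zero => simp
  | add x y _ _ hx hy =>
    simp only [map_add, LinearMap.add_apply, add_smul, Finset.sum_add_distrib]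
    rw [← hx, ← hy]
  | smul c x _ hx =>
    simp only [map_smul, LinearMap.smul_apply, smul_assoc, ← Finset.smul_sum]
    rw [← hx]

/-! ### The filtration by dominance -/

/-- The span of the `q_μ` with `μ ≥ λ`. -/
noncomputable def qSpan (la : n.Partition) : Submodule F Sym :=
  Submodule.span F (q '' (above la : Set n.Partition))

theorem q_mem_qSpan {la mu : n.Partition} (h : Dom la mu) : q mu ∈ qSpan la :=
  Submodule.subset_span ⟨mu, Finset.mem_coe.2 (mem_above.2 h), rfl⟩

theorem qSpan_le {la : n.Partition} {S : Submodule F Sym} (h : ∀ mu, Dom la mu → q mu ∈ S) :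
    qSpan la ≤ S := by
  refine Submodule.span_le.2 ?_
  rintro _ ⟨mu, hmu, rfl⟩
  exact h mu (mem_above.1 (Finset.mem_coe.1 hmu))

theorem qSpan_anti {la mu : n.Partition} (h : Dom la mu) : qSpan mu ≤ qSpan la :=
  qSpan_le fun _ h' => q_mem_qSpan (h.trans h')

theorem lb_mem_qSpan {la : n.Partition} {f : Sym} (hf : f ∈ qSpan la) : lb n f ∈ qSpan la := by
  classical
  have : qSpan la ≤ (qSpan la).comap (lb n) := by
    refine qSpan_le fun mu hmu => ?_
    rw [Submodule.mem_comap, lb_q]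
    refine Submodule.add_mem _ (Submodule.smul_mem _ _ (q_mem_qSpan hmu))
      (Submodule.sum_mem _ fun nu _ => ?_)
    split_ifs with h
    · obtain ⟨i, j, k, h⟩ := h
      exact Submodule.smul_mem _ _ (q_mem_qSpan (hmu.trans h.dom))
    · rw [zero_smul]
      exact Submodule.zero_mem _
  exact this hf

theorem IsJackFamily.jackForm_qSpan (hP : IsJackFamily n P) {la mu : n.Partition} (h : ¬ Dom la mu)
    {f : Sym} (hf : f ∈ qSpan la) : jackForm (P mu) f = 0 := by
  have : qSpan la ≤ LinearMap.ker (jackForm (P mu)) :=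
    qSpan_le fun nu hnu => hP.jackForm_q_of_not_dom fun h' => h (hnu.trans h')
  exact this hf

/-- The expansion of `q_λ` in the dual Jack functions has coefficient `1` at `Q_λ` and otherwise
involves only `Q_κ` with `κ > λ`; solving for `Q_λ` allows induction down the dominance order. -/
theorem IsJackFamily.dualJack_mem_qSpan (hP : IsJackFamily n P) (la : n.Partition) :
    dualJack P la ∈ qSpan la := by
  classical
  induction la using wellFounded_dom_swap.induction with
  | _ la ih =>
    have h := hP.eq_sum_dualJack (hP.q_mem_span la)
    rw [← Finset.add_sum_erase _ _ (Finset.mem_univ la), jackForm_comm, hP.jackForm_q_self,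
      one_smul] at h
    rw [eq_sub_of_add_eq h.symm]
    refine Submodule.sub_mem _ (q_mem_qSpan (Dom.refl la)) (Submodule.sum_mem _ fun ka hka => ?_)
    have hne := Finset.ne_of_mem_erase hka
    by_cases hd : Dom la ka
    · exact Submodule.smul_mem _ _ (qSpan_anti hd (ih ka ⟨hd, hne.symm⟩))
    · rw [jackForm_comm, hP.jackForm_q_of_not_dom hd, zero_smul]
      exact Submodule.zero_mem _

theorem IsJackFamily.exists_eq_sum_q (hP : IsJackFamily n P) (la : n.Partition) :
    ∃ C : n.Partition → F, dualJack P la = ∑ mu ∈ above la, C mu • q mu := by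
  obtain ⟨C, hC⟩ := (Submodule.mem_span_image_finset_iff_exists_fun' F).1 (hP.dualJack_mem_qSpan la)
  exact ⟨C, hC.symm⟩

/-! ### The eigenvector equation and the recursion -/

/-- The dual Jack functions are eigenvectors of the Laplace–Beltrami operator. -/
theorem IsJackFamily.lb_dualJack (hP : IsJackFamily n P) (la : n.Partition) :
    lb n (dualJack P la) = lbEigenvalue la • dualJack P la := by
  classical
  have hE := lb_mem_qSpan (hP.dualJack_mem_qSpan la)
  have hspan : lb n (dualJack P la) ∈ Submodule.span F (Set.range P) :=
    qSpan_le (fun mu _ => hP.q_mem_span mu) hE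
  have hzero : ∀ ka, ka ≠ la → jackForm (lb n (dualJack P la)) (P ka) = 0 := by
    intro ka hka
    -- Triangularity of the operator kills the pairing unless `κ ≥ λ`; self-adjointness gives the
    -- same with the roles exchanged, so only `κ = λ` survives.
    by_cases h1 : Dom la ka
    · have h2 : ¬ Dom ka la := fun h2 => hka (h2.antisymm h1)
      rw [jackForm_lb, ← hP.smul_dualJack ka, map_smul, map_smul, dualJack, map_smul,
        LinearMap.smul_apply,
        hP.jackForm_qSpan h2 (lb_mem_qSpan (hP.dualJack_mem_qSpan ka)), smul_zero, smul_zero]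
    · rw [jackForm_comm, hP.jackForm_qSpan h1 hE]
  have hdiag : jackForm (lb n (dualJack P la)) (P la) = lbEigenvalue la := by
    obtain ⟨C, hC⟩ := hP.exists_eq_sum_q la
    have hla := mem_above.2 (Dom.refl la)
    have hC1 : C la = 1 := by
      have := hP.jackForm_dualJack_self la
      rw [hC, jackForm_comm, map_sum, Finset.sum_eq_single_of_mem la hla, map_smul,
        hP.jackForm_q_self, smul_eq_mul, mul_one] at this
      · exact this
      · intro mu hmu hne
        rw [map_smul, hP.jackForm_q_of_not_dom, smul_zero]
        exact fun h => hne (h.antisymm (mem_above.1 hmu))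
    have hq : jackForm (P la) (lb n (q la)) = lbEigenvalue la := by
      rw [lb_q, map_add, map_smul, hP.jackForm_q_self, smul_eq_mul, mul_one, map_sum,
        Finset.sum_eq_zero, add_zero]
      intro mu _
      rw [map_smul]
      split_ifs with h
      · obtain ⟨i, j, k, h⟩ := h
        rw [hP.jackForm_q_of_not_dom fun h' => h.ne (h'.antisymm h.dom), smul_zero]
      · rw [zero_smul]
    rw [hC, jackForm_comm, map_sum, map_sum, Finset.sum_eq_single_of_mem la hla, map_smul, map_smul,
      hq, hC1, one_smul]
    intro mu hmu hne
    rw [map_smul, map_smul, hP.jackForm_qSpan (la := mu) (fun h => hne (h.antisymm (mem_above.1 hmu)))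
      (lb_mem_qSpan (q_mem_qSpan (Dom.refl mu))), smul_zero]
  rw [hP.eq_sum_dualJack hspan, Finset.sum_eq_single_of_mem la (Finset.mem_univ _), hdiag]
  intro ka _ hka
  rw [hzero ka hka, zero_smul]

/-- The recursion satisfied by the coefficients of a dual Jack function in the `q_μ`. -/
theorem IsJackFamily.recursion (hP : IsJackFamily n P) {la : n.Partition} {C : n.Partition → F}
    (hC : dualJack P la = ∑ mu ∈ above la, C mu • q mu) {mu : n.Partition} (h : Dom la mu) :
    C mu * (e' la - e' mu) = ∑ nu ∈ movingDown mu with Dom la nu, C nu * r nu mu := by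
  classical
  -- Pairing with `g` reads off the coefficient of `q_μ` in any expansion, so no separate uniqueness
  -- statement for `C` is needed.
  obtain ⟨g, -, h1, h0⟩ := hP.exists_dual mu
  have hg : ∀ D : n.Partition → F, ∀ s : Finset n.Partition, mu ∈ s →
      jackForm g (∑ nu ∈ s, D nu • q nu) = D mu := by
    intro D s hs
    rw [map_sum, Finset.sum_eq_single_of_mem mu hs, map_smul, h1, smul_eq_mul, mul_one]
    intro nu _ hne
    rw [map_smul, h0 nu hne, smul_zero]
  have hmu := mem_above.2 h
  have hL : jackForm g (lb n (dualJack P la)) = lbEigenvalue la * C mu := by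
    rw [hP.lb_dualJack, map_smul, hC, hg C _ hmu, smul_eq_mul]
  have hR : jackForm g (lb n (dualJack P la)) = C mu * lbEigenvalue mu +
      ∑ nu ∈ above la, C nu * (if mu ∈ movingUp nu then r nu mu else 0) := by
    rw [hC, map_sum]
    simp only [map_smul, lb_q, smul_add, smul_smul, Finset.sum_add_distrib]
    rw [map_add, hg (fun nu => C nu * lbEigenvalue nu) _ hmu, map_sum]
    congr 1
    refine Finset.sum_congr rfl fun nu _ => ?_
    rw [map_smul, hg (fun ka => if ka ∈ movingUp nu then r nu ka else 0) _ (Finset.mem_univ _),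
      smul_eq_mul]
  have hS : ∑ nu ∈ above la, C nu * (if mu ∈ movingUp nu then r nu mu else 0) =
      ∑ nu ∈ movingDown mu with Dom la nu, C nu * r nu mu := by
    simp only [mul_ite, mul_zero]
    rw [← Finset.sum_filter]
    refine Finset.sum_congr ?_ fun _ _ => rfl
    ext nu
    simp [mem_above, movingDown, and_comm]
  rw [← hS]
  have := hL.symm.trans hR
  -- The parts of the two eigenvalues depending only on `n` cancel, leaving `e'_λ - e'_μ`.
  simp only [lbEigenvalue] at this
  linear_combination this

end Jack

theorem theorem5p5 (n : ℕ) (P : n.Partition → Jack.Sym) (hP : Jack.IsJackFamily n P)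
    (la : n.Partition) :
    (∃ C : n.Partition → Jack.F,
      Jack.dualJack P la = ∑ mu ∈ Jack.above la, C mu • Jack.q mu) ∧
    ∀ C : n.Partition → Jack.F,
      Jack.dualJack P la = ∑ mu ∈ Jack.above la, C mu • Jack.q mu →
      ∀ mu : n.Partition, Jack.Dom la mu → mu ≠ la →
        Jack.e' la - Jack.e' mu ≠ 0 ∧
        C mu = (∑ nu ∈ Jack.movingDown mu with Jack.Dom la nu, C nu * Jack.r nu mu) /
          (Jack.e' la - Jack.e' mu) := by
  refine ⟨hP.exists_eq_sum_q la, fun C hC mu hmu hne => ?_⟩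
  have he := Jack.e'_sub_e'_ne_zero hmu hne
  exact ⟨he, (eq_div_iff he).2 (hP.recursion hC hmu)⟩
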